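/- Let $G$ be a (simple, possibly infinite, not necessarily connected) graph with edge set $E(G)$ and let $\ell:E(G)\to\mathbb R_{>0}$ be an assignment of edge lengths. Regard $G$ as a 1-complex in which each edge $e$ is a copy of the real interval $[0,\ell(e)]$. For points $x,y$ of this 1-complex let $d_\ell(x,y)\in[0,\infty]$ be the infimum of the lengths of the arcs from $x$ to $y$ in $G$, where the length of an arc is the sum of the lengths of the edges and maximal half-edges it consists of (so $d_\ell(x,x)=0$, for vertices $x,y$ it is the infimum of $\sum_{e\in E(P)}\ell(e)$ over all $x$--$y$ paths $P$ in $G$, and $d_\ell(x,y)=\infty$ if $x,y$ lie in different components of $G$). Let $|G|_\ell$ be the completion of the space obtained from $G$ by identifying points at distance $0$. A half-edge is a connected subset of an edge; its length is that of the corresponding subinterval of $[0,\ell(e)]$. An arc (a circle) in $|G|_\ell$ is a subset homeomorphic to $[0,1]$ (to the unit circle $S^1$). The length $\ell(C)$ of an arc or circle $C$ is the length $\sup\sum_{i} d_\ell(\gamma(s_i),\gamma(s_{i+1}))$, the supremum being taken over all finite sequences $0=s_1<s_2<\dots<s_k=1$, of a continuous surjective map $\gamma:[0,1]\to C$ that is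 injective on $(0,1)$; part of the claim below is that it does not depend on the choice of $\gamma$. Let $E(C)$ denote the set of edges contained in $C$. **Lemma.** Suppose that $\sum_{e\in E(G)}\ell(e)<\infty$. Then: 1. for every circle $C$ in $|G|_\ell$ we have $\ell(C)=\sum_{e\in E(C)}\ell(e)$; 2. for every arc $C$ in $|G|_\ell$ neither of whose endpoints is an inner point of an edge we have $\ell(C)=\sum_{e\in E(C)}\ell(e)$; 3. for every arc $C$ in $|G|_\ell$ the length $\ell(C)$ is the sum of the lengths of the maximal half-edges contained in $C$ (a full edge contained in $C$ counting as a half-edge). -/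

import Mathlib

open Set Filter Topology
open scoped ENNReal

/-! ### Arcs, circles and their lengths -/

section Curves

variable {X : Type*}

/-- An arc: a homeomorphic image of the interval `[0, 1]`. -/
def IsArc [TopologicalSpace X] (C : Set X) : Prop := Nonempty (unitInterval ≃ₜ C)

/-- A circle: a homeomorphic copy of the unit circle. -/
def IsCircle [TopologicalSpace X] (C : Set X) : Prop := Nonempty (Circle ≃ₜ C)

/-- The endpoints of an arc `C`: the images of `0` and `1` under a homeomorphism `[0, 1] ≃ C`. -/
def IsEndpoint [TopologicalSpace X] (C : Set X) (x : X) : Prop :=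
  ∃ h : unitInterval ≃ₜ C, (h 0 : X) = x ∨ (h 1 : X) = x

/-- A surjective topological path `[0, 1] → C` that is injective on `(0, 1)`. -/
structure IsParametrization [TopologicalSpace X] (C : Set X) (γ : unitInterval → X) : Prop where
  continuous : Continuous γ
  range_eq : range γ = C
  injOn : InjOn γ (Ioo 0 1)

/-- The length of a topological path `γ : [0, 1] → X`: the supremum of the sums
`∑ d(γ sᵢ, γ sᵢ₊₁)` over all finite increasing sequences in `[0, 1]`. -/
noncomputable def pathLength [PseudoEMetricSpace X] (γ : unitInterval → X) : ℝ≥0∞ := eVariationOn γ univ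

/-- `C` has length `L`: there is a surjective path `[0, 1] → C` injective on `(0, 1)`, and every
such path has length `L`. -/
def HasLength [PseudoEMetricSpace X] (C : Set X) (L : ℝ≥0∞) : Prop :=
  (∃ γ : unitInterval → X, IsParametrization C γ) ∧ ∀ γ : unitInterval → X, IsParametrization C γ → pathLength γ = L

end Curves

/-! ### The completion of a space with a (possibly infinite) pseudometric -/

section Completion

/-- The Cauchy sequences of `X`. -/
def CauchySequences (X : Type*) [PseudoEMetricSpace X] : Type _ := {u : ℕ → X // CauchySeq u}

/-- The distance of two Cauchy sequences is the limit (here written as a `limsup`) of the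
distances of their terms. -/
noncomputable instance (X : Type*) [PseudoEMetricSpace X] :
    PseudoEMetricSpace (CauchySequences X) where
  edist u v := limsup (fun n => edist (u.1 n) (v.1 n)) atTop
  edist_self u := by simp
  edist_comm u v := by simp only [edist_comm]
  edist_triangle u v w := by
    refine le_trans (limsup_le_limsup (Eventually.of_forall fun n =>
      edist_triangle (u.1 n) (v.1 n) (w.1 n))) ?_
    have h : ∀ p : ℕ → ℝ≥0∞, ∀ q : ℕ → ℝ≥0∞, limsup (fun n => p n + q n) atTop ≤
        limsup p atTop + limsup q atTop := fun p q => by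
      refine ENNReal.le_of_forall_pos_le_add fun ε hε hfin => ?_
      have hp := ENNReal.lt_add_right (ne_top_of_le_ne_top hfin.ne le_self_add)
        (ENNReal.half_pos (ENNReal.coe_pos.2 hε).ne').ne'
      have hq := ENNReal.lt_add_right (ne_top_of_le_ne_top hfin.ne le_add_self)
        (ENNReal.half_pos (ENNReal.coe_pos.2 hε).ne').ne'
      refine limsup_le_of_le (by isBoundedDefault) ?_
      filter_upwards [eventually_lt_of_limsup_lt hp, eventually_lt_of_limsup_lt hq] with n h₁ h₂
      refine (add_le_add h₁.le h₂.le).trans (le_of_eq ?_)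
      rw [add_add_add_comm, ENNReal.add_halves]
    exact h _ _

/-- The completion of `X`: Cauchy sequences, identified when their distance is `0`. In particular
two points of `X` at distance `0` give the same point of the completion. -/
def MetricCompletion (X : Type*) [PseudoEMetricSpace X] : Type _ :=
  SeparationQuotient (CauchySequences X)

noncomputable instance (X : Type*) [PseudoEMetricSpace X] : EMetricSpace (MetricCompletion X) :=
  inferInstanceAs (EMetricSpace (SeparationQuotient (CauchySequences X)))

/-- The point of the completion represented by a Cauchy sequence. -/
noncomputable def MetricCompletion.mk {X : Type*} [PseudoEMetricSpace X] (u : CauchySequences X) :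
    MetricCompletion X := SeparationQuotient.mk u

/-- The canonical map of `X` into its completion, by constant sequences. -/
noncomputable def MetricCompletion.of {X : Type*} [PseudoEMetricSpace X] (x : X) : MetricCompletion X :=
  MetricCompletion.mk ⟨fun _ => x, cauchySeq_const x⟩

theorem MetricCompletion.isometry_of {X : Type*} [PseudoEMetricSpace X] :
    Isometry (MetricCompletion.of : X → MetricCompletion X) := fun x y => by
  change limsup (fun _ : ℕ => edist x y) atTop = _
  simp

theorem MetricCompletion.tendsto_of {X : Type*} [PseudoEMetricSpace X] (u : CauchySequences X) :
    Tendsto (fun n => MetricCompletion.of (u.1 n)) atTop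
      (𝓝 (MetricCompletion.mk u)) := by
  refine EMetric.tendsto_atTop.2 fun ε hε => ?_
  obtain ⟨δ, hδ, hδε⟩ := exists_between hε
  obtain ⟨N, hN⟩ := EMetric.cauchySeq_iff.1 u.2 δ hδ
  refine ⟨N, fun n hn => lt_of_le_of_lt ?_ hδε⟩
  change limsup (fun k => edist (u.1 n) (u.1 k)) atTop ≤ δ
  exact limsup_le_of_le (by isBoundedDefault)
    (eventually_atTop.2 ⟨N, fun k hk => (hN n hn k hk).le⟩)

theorem MetricCompletion.denseRange_of {X : Type*} [PseudoEMetricSpace X] :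
    DenseRange (MetricCompletion.of : X → MetricCompletion X) := by
  intro z
  obtain ⟨u, rfl⟩ := SeparationQuotient.surjective_mk z
  exact mem_closure_of_tendsto (MetricCompletion.tendsto_of u)
    (Eventually.of_forall fun n => mem_range_self _)

instance (X : Type*) [PseudoEMetricSpace X] : CompleteSpace (MetricCompletion X) := by
  refine EMetric.complete_of_cauchySeq_tendsto fun z hz => ?_
  have hpos : ∀ n : ℕ, (0 : ℝ≥0∞) < ((n : ℝ≥0∞) + 1)⁻¹ := fun n => by simp
  have hx : ∀ n, ∃ x : X, edist (z n) (MetricCompletion.of x) < ((n : ℝ≥0∞) + 1)⁻¹ := fun n => by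
    obtain ⟨_, ⟨x, rfl⟩, hx⟩ := EMetric.mem_closure_iff.1 (MetricCompletion.denseRange_of (z n))
      _ (hpos n)
    exact ⟨x, hx⟩
  choose x hx using hx
  have hlim : Tendsto (fun n => edist (z n) (MetricCompletion.of (x n))) atTop (𝓝 0) := by
    refine tendsto_of_tendsto_of_tendsto_of_le_of_le tendsto_const_nhds
      (?_ : Tendsto (fun n : ℕ => ((n : ℝ≥0∞) + 1)⁻¹) atTop (𝓝 0))
      (fun n => zero_le) (fun n => (hx n).le)
    have := ENNReal.tendsto_inv_nat_nhds_zero.comp (tendsto_add_atTop_nat 1)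
    refine this.congr fun n => ?_
    simp
  have hxc : CauchySeq x := by
    refine EMetric.cauchySeq_iff.2 fun ε hε => ?_
    have hε3 : 0 < ε / 3 := ENNReal.div_pos hε.ne' (by simp)
    obtain ⟨N, hN⟩ := EMetric.cauchySeq_iff.1 hz _ hε3
    obtain ⟨M, hM⟩ := eventually_atTop.1 (hlim.eventually (gt_mem_nhds hε3))
    refine ⟨max M N, fun m hm n hn => ?_⟩
    rw [← MetricCompletion.isometry_of (x m) (x n)]
    refine lt_of_le_of_lt (edist_triangle4 _ (z m) (z n) _) ?_
    rw [edist_comm _ (z m), ← ENNReal.add_thirds ε]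
    exact ENNReal.add_lt_add (ENNReal.add_lt_add (hM m (le_of_max_le_left hm))
      (hN m (le_of_max_le_right hm) n (le_of_max_le_right hn))) (hM n (le_of_max_le_left hn))
  refine ⟨MetricCompletion.mk ⟨x, hxc⟩, ?_⟩
  refine tendsto_iff_edist_tendsto_0.2 ?_
  refine tendsto_of_tendsto_of_tendsto_of_le_of_le tendsto_const_nhds
    (by simpa using hlim.add (tendsto_iff_edist_tendsto_0.1 (MetricCompletion.tendsto_of ⟨x, hxc⟩)))
    (fun n => zero_le) (fun n => edist_triangle _ _ _)

end Completion

/-! ### A graph with edge lengths as a 1-complex, and its completion -/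

namespace LengthGraph

variable {V : Type*} {G : SimpleGraph V}

/-- The first endvertex of an edge, in an arbitrarily fixed orientation. -/
noncomputable def src (e : G.edgeSet) : V := (Quot.out (e : Sym2 V)).1

/-- The second endvertex of an edge. -/
noncomputable def tgt (e : G.edgeSet) : V := (Quot.out (e : Sym2 V)).2

theorem mk_src_tgt (e : G.edgeSet) : s(src e, tgt e) = (e : Sym2 V) := Quot.out_eq _

theorem adj_src_tgt (e : G.edgeSet) : G.Adj (src e) (tgt e) := by
  rw [← SimpleGraph.mem_edgeSet, mk_src_tgt]; exact e.2

/-- The points of the 1-complex `G`: the vertices, and the inner points of edges. Every edge `e` is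
a copy of the interval `[0, ℓ e]`, the number `t` being the distance from `src e` along `e`. -/
inductive Point (G : SimpleGraph V) (ℓ : G.edgeSet → ℝ)
  | vertex (v : V) : Point G ℓ
  | inner (e : G.edgeSet) (t : ℝ) (h₀ : 0 < t) (h₁ : t < ℓ e) : Point G ℓ

variable (ℓ : G.edgeSet → ℝ)

/-- The length of a walk, the sum of the lengths of its edges. -/
noncomputable def walkLength {u v : V} (p : G.Walk u v) : ℝ≥0∞ :=
  (p.darts.map fun d => ENNReal.ofReal (ℓ ⟨d.edge, d.edge_mem⟩)).sum

/-- `d(u, v)` for vertices: the infimum of the lengths of the `u`-`v` paths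
(`∞` if there is no such path). -/
noncomputable def vertexDist (u v : V) : ℝ≥0∞ :=
  ⨅ (p : G.Walk u v) (_ : p.IsPath), walkLength ℓ p

open Classical in
/-- The length of the half-edge (or edge-free trivial piece) from `x` to the vertex `a`: for an
inner point `x` of an edge it is finite precisely for the two endvertices `a` of that edge, for a
vertex `x` it is finite (and `0`) only for `a = x`. -/
noncomputable def toVertex : Point G ℓ → V → ℝ≥0∞
  | .vertex v, a => if a = v then 0 else ⊤
  | .inner e t _ _, a =>
      if a = src e then ENNReal.ofReal t
      else if a = tgt e then ENNReal.ofReal (ℓ e - t) else ⊤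

open Classical in
/-- The length of the segment between two inner points of one edge (`∞` for all other pairs). -/
noncomputable def segmentDist : Point G ℓ → Point G ℓ → ℝ≥0∞
  | .inner e s _ _, .inner f t _ _ => if e = f then ENNReal.ofReal |s - t| else ⊤
  | .inner _ _ _ _, .vertex _ => ⊤
  | .vertex _, _ => ⊤

/-- The infimum of the lengths of the connections that leave `x` along a half-edge to a vertex `a`,
follow a path of `G` from `a` to `b`, and reach `y` along a half-edge. -/
noncomputable def throughDist (x y : Point G ℓ) : ℝ≥0∞ :=
  ⨅ (a : V) (b : V), toVertex ℓ x a + vertexDist ℓ a b + toVertex ℓ y b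

/-- The distance `d_ℓ(x, y)`: the infimum of the lengths of the arcs from `x` to `y` in the
1-complex `G`. Such an arc is a segment of one edge or consists of a path of `G` and at most two
half-edges. -/
noncomputable def pointDist (x y : Point G ℓ) : ℝ≥0∞ := min (segmentDist ℓ x y) (throughDist ℓ x y)

theorem vertexDist_le_walkLength {u v : V} (p : G.Walk u v) :
    vertexDist ℓ u v ≤ walkLength ℓ p := by
  classical
  refine le_trans (iInf₂_le p.bypass p.bypass_isPath) ?_
  exact (p.darts_bypass_sublist_darts.map _).sum_le_sum (fun _ _ => zero_le)

theorem vertexDist_self (u : V) : vertexDist ℓ u u = 0 :=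
  le_antisymm (le_trans (vertexDist_le_walkLength ℓ .nil) (by simp [walkLength])) (zero_le)

theorem vertexDist_le_symm (u v : V) : vertexDist ℓ v u ≤ vertexDist ℓ u v := by
  refine le_iInf₂ fun p _ => le_trans (vertexDist_le_walkLength ℓ p.reverse) (le_of_eq ?_)
  simp [walkLength, Function.comp_def, List.sum_reverse]

theorem vertexDist_comm (u v : V) : vertexDist ℓ u v = vertexDist ℓ v u :=
  le_antisymm (vertexDist_le_symm ℓ v u) (vertexDist_le_symm ℓ u v)

theorem vertexDist_triangle (u v w : V) :
    vertexDist ℓ u w ≤ vertexDist ℓ u v + vertexDist ℓ v w := by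
  conv_rhs => rw [vertexDist, vertexDist]
  simp only [ENNReal.iInf_add, ENNReal.add_iInf]
  refine le_iInf₂ fun q _ => le_iInf₂ fun p _ =>
    le_trans (vertexDist_le_walkLength ℓ (p.append q)) (le_of_eq ?_)
  simp [walkLength]

theorem vertexDist_src_tgt (e : G.edgeSet) :
    vertexDist ℓ (src e) (tgt e) ≤ ENNReal.ofReal (ℓ e) := by
  refine le_trans (vertexDist_le_walkLength ℓ (.cons (adj_src_tgt e) .nil)) (le_of_eq ?_)
  have h : (⟨s(src e, tgt e), adj_src_tgt e⟩ : G.edgeSet) = e := Subtype.ext (mk_src_tgt e)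
  simp [walkLength, SimpleGraph.Dart.edge, h]

theorem vertexDist_le_toVertex_add (y : Point G ℓ) (b c : V) :
    vertexDist ℓ b c ≤ toVertex ℓ y b + toVertex ℓ y c := by
  cases y with
  | vertex v =>
    simp only [toVertex]
    split_ifs with h₁ h₂ h₃
    · simp [h₁, h₂, vertexDist_self]
    all_goals simp
  | inner e t h₀ h₁ =>
    have key : ENNReal.ofReal t + ENNReal.ofReal (ℓ e - t) = ENNReal.ofReal (ℓ e) := by
      rw [← ENNReal.ofReal_add h₀.le (by linarith)]; congr 1; ring
    have h := vertexDist_src_tgt ℓ e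
    simp only [toVertex]
    split_ifs with hb hc hc hb' hc hc
    all_goals (try subst hb); (try subst hc); (try subst hb')
    all_goals first
      | simp; done
      | (simp [vertexDist_self]; done)
      | (rw [key]; exact h)
      | (rw [vertexDist_comm, add_comm, key]; exact h)

theorem toVertex_le_segmentDist_add (x y : Point G ℓ) (a : V) :
    toVertex ℓ x a ≤ segmentDist ℓ x y + toVertex ℓ y a := by
  cases x <;> cases y <;> simp only [segmentDist, top_add, le_top]
  rename_i e s hs₀ hs₁ f t ht₀ ht₁
  split_ifs with h
  · subst h
    simp only [toVertex]
    split_ifs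
    · rw [← ENNReal.ofReal_add (abs_nonneg _) ht₀.le]
      exact ENNReal.ofReal_le_ofReal (by linarith [le_abs_self (s - t)])
    · rw [← ENNReal.ofReal_add (abs_nonneg _) (by linarith)]
      exact ENNReal.ofReal_le_ofReal (by linarith [neg_abs_le (s - t)])
    · simp
  · simp

theorem segmentDist_comm (x y : Point G ℓ) : segmentDist ℓ x y = segmentDist ℓ y x := by
  cases x <;> cases y <;> simp only [segmentDist]
  rename_i e s _ _ f t _ _
  by_cases h : e = f
  · rw [if_pos h, if_pos h.symm, abs_sub_comm]
  · rw [if_neg h, if_neg (Ne.symm h)]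

theorem segmentDist_triangle (x y z : Point G ℓ) :
    segmentDist ℓ x z ≤ segmentDist ℓ x y + segmentDist ℓ y z := by
  cases x <;> cases y <;> cases z <;> simp only [segmentDist, top_add, add_top, le_top]
  split_ifs with h₁ h₂ h₃ h₄ h₅ <;> try simp
  · rw [← ENNReal.ofReal_add (abs_nonneg _) (abs_nonneg _)]
    exact ENNReal.ofReal_le_ofReal (abs_sub_le _ _ _)
  · simp_all

theorem throughDist_comm (x y : Point G ℓ) : throughDist ℓ x y = throughDist ℓ y x := by
  rw [throughDist, throughDist, iInf_comm]
  refine iInf_congr fun b => iInf_congr fun a => ?_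
  rw [vertexDist_comm]; ring

theorem throughDist_le_segmentDist_add (x y z : Point G ℓ) :
    throughDist ℓ x z ≤ segmentDist ℓ x y + throughDist ℓ y z := by
  conv_rhs => rw [throughDist]
  simp only [ENNReal.add_iInf]
  refine le_iInf₂ fun a b => le_trans (iInf₂_le a b) ?_
  rw [← add_assoc, ← add_assoc]
  gcongr
  exact toVertex_le_segmentDist_add ℓ x y a

theorem throughDist_triangle (x y z : Point G ℓ) :
    throughDist ℓ x z ≤ throughDist ℓ x y + throughDist ℓ y z := by
  conv_rhs => rw [throughDist, throughDist]
  simp only [ENNReal.iInf_add, ENNReal.add_iInf]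
  refine le_iInf fun c => le_iInf fun d => le_iInf fun a => le_iInf fun b => ?_
  refine le_trans (iInf₂_le a d) ?_
  calc toVertex ℓ x a + vertexDist ℓ a d + toVertex ℓ z d
      ≤ toVertex ℓ x a + (vertexDist ℓ a b + (toVertex ℓ y b + toVertex ℓ y c) +
          vertexDist ℓ c d) + toVertex ℓ z d := by
        gcongr
        refine (vertexDist_triangle ℓ a c d).trans ?_
        gcongr
        refine (vertexDist_triangle ℓ a b c).trans ?_
        gcongr
        exact vertexDist_le_toVertex_add ℓ y b c
    _ = _ := by ring

/-- The (possibly infinite) pseudometric `d_ℓ` on the 1-complex `G`. -/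
noncomputable instance : PseudoEMetricSpace (Point G ℓ) where
  edist := pointDist ℓ
  edist_self x := by
    refine le_antisymm ?_ (zero_le)
    cases x with
    | vertex v =>
      exact (min_le_right _ _).trans ((iInf₂_le v v).trans (by simp [toVertex, vertexDist_self]))
    | inner e t h₀ h₁ => exact (min_le_left _ _).trans (by simp [segmentDist])
  edist_comm x y := by
    rw [pointDist, pointDist, segmentDist_comm, throughDist_comm]
  edist_triangle x y z := by
    simp only [pointDist, min_add, add_min, le_min_iff]
    refine ⟨⟨(min_le_left _ _).trans (segmentDist_triangle ℓ x y z), ?_⟩, ?_, ?_⟩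
    · rw [throughDist_comm ℓ x z, throughDist_comm ℓ x y, segmentDist_comm ℓ y z, add_comm]
      exact (min_le_right _ _).trans (throughDist_le_segmentDist_add ℓ z y x)
    · exact (min_le_right _ _).trans (throughDist_le_segmentDist_add ℓ x y z)
    · exact (min_le_right _ _).trans (throughDist_triangle ℓ x y z)

/-- The space `|G|_ℓ`: the completion of the 1-complex `G` with respect to `d_ℓ`, points at
distance `0` being identified. -/
abbrev Space (G : SimpleGraph V) (ℓ : G.edgeSet → ℝ) : Type _ := MetricCompletion (Point G ℓ)

/-- The point of the closed edge `e` that corresponds to `t ∈ [0, ℓ e]`. -/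
noncomputable def edgePoint (e : G.edgeSet) (t : Icc 0 (ℓ e)) : Point G ℓ :=
  if h₀ : 0 < (t : ℝ) then
    if h₁ : (t : ℝ) < ℓ e then .inner e t h₀ h₁ else .vertex (tgt e)
  else .vertex (src e)

/-- `E(X)`: the set of edges contained in `X ⊆ |G|_ℓ`. -/
def edgesIn (X : Set (Space G ℓ)) : Set G.edgeSet :=
  {e | ∀ t : Icc 0 (ℓ e), MetricCompletion.of (edgePoint ℓ e t) ∈ X}

/-- The part of the edge `e`, as a subset of `[0, ℓ e]`, that lies in `X ⊆ |G|_ℓ`. -/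
def edgeTrace (X : Set (Space G ℓ)) (e : G.edgeSet) : Set ℝ :=
  {t | ∃ h : t ∈ Icc 0 (ℓ e), MetricCompletion.of (edgePoint ℓ e ⟨t, h⟩) ∈ X}

/-- The set of maximal half-edges contained in `X ⊆ |G|_ℓ`: the pairs of an edge `e` and a maximal
connected subset `J` of the part of `e` that lies in `X`. (The one-point connected sets have
length `0`.) -/
def maxHalfEdgesIn (X : Set (Space G ℓ)) : Set (G.edgeSet × Set ℝ) :=
  {p | Maximal (fun J : Set ℝ => IsConnected J ∧ J ⊆ edgeTrace ℓ X p.1) p.2}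

/-- The length of a half-edge, the length of the corresponding subinterval of `[0, ℓ e]`. -/
noncomputable def halfEdgeLength (p : G.edgeSet × Set ℝ) : ℝ≥0∞ := MeasureTheory.volume p.2

/-- `x` is an inner point of an edge. -/
def IsInnerPoint (x : Space G ℓ) : Prop :=
  ∃ (e : G.edgeSet) (t : ℝ) (h₀ : 0 < t) (h₁ : t < ℓ e),
    x = MetricCompletion.of (Point.inner e t h₀ h₁)

end LengthGraph

/-! ### The metric of `|G|_ℓ` along an edge and near its inner points. -/

namespace LengthGraph

variable {V : Type*} {G : SimpleGraph V} {ℓ : G.edgeSet → ℝ}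

/-! All three claims reduce to one identity, `pathLength_eq_traceLength`: every parametrization of
`C` has length `traceLength ℓ C`, the total Lebesgue measure of the parts of edges lying in `C`. The
right side depends only on `C`, so independence of the parametrization comes for free.

Lower bound on the path length (`traceLength_range_le_pathLength`): well inside an edge, short
distances are just differences of the edge coordinate, and different edges are far apart. So if the
path is cut into pieces of small diameter, each piece meets the cores of edges in measure at most
its diameter. Sum over the pieces and let the cores grow.

Upper bound (`pathLength_le_traceLength_range`): the crux is `edist_le_traceLength`, that a
connected set `K` containing `x` and `y` has total edge measure at least `d(x, y)`. The truncated
distance from `x` maps `K` onto a set containing `[0, d(x, y)]`. Inner points of edges account for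
measure at most `traceLength ℓ K`; the remaining points, including all limit points added by the
completion, have null image by `volume_image_not_isInnerPoint`. That lemma is where summability
matters: after removal of finitely many edges, everything else in a component of `G` has its values
in finitely many intervals of total length at most the tail of `∑ ℓ e`, and passing to limits only
adds the endpoints of these intervals. Applied to subpaths, which overlap in countable sets, the
bound adds up along the path.

It remains to compute `traceLength ℓ C`. By the intermediate value theorem, `C` contains a
neighbourhood, within the edge, of each inner point of an edge that it meets other than an endpoint
of an arc (`eventually_edgeMap_mem_image`). Without such endpoints, an edge is either contained in
`C` or met at most in its ends. For a general arc, each edge trace is open up to a countable set,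
and its measure is the sum over its components. -/

theorem edist_le_through (x y : Point G ℓ) (a b : V) :
    edist x y ≤ toVertex ℓ x a + vertexDist ℓ a b + toVertex ℓ y b :=
  (min_le_right _ _).trans ((iInf_le _ a).trans (iInf_le _ b))

theorem edgePoint_of_mem_Ioo (e : G.edgeSet) {t : ℝ} (ht : t ∈ Ioo 0 (ℓ e)) :
    edgePoint ℓ e ⟨t, Ioo_subset_Icc_self ht⟩ = .inner e t ht.1 ht.2 := by
  simp [edgePoint, ht.1, ht.2]

theorem toVertex_edgePoint_src_le (e : G.edgeSet) (t : Icc 0 (ℓ e)) (ht : (t : ℝ) < ℓ e) :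
    toVertex ℓ (edgePoint ℓ e t) (src e) ≤ ENNReal.ofReal t := by
  unfold edgePoint
  split_ifs <;> simp [toVertex]

theorem toVertex_edgePoint_tgt_le (e : G.edgeSet) (t : Icc 0 (ℓ e)) (ht : 0 < (t : ℝ)) :
    toVertex ℓ (edgePoint ℓ e t) (tgt e) ≤ ENNReal.ofReal (ℓ e - t) := by
  unfold edgePoint
  split_ifs <;> simp [toVertex, (adj_src_tgt e).ne']

/-- `segmentDist` is finite only between inner points, so as soon as an end of the edge is involved
the bound has to come from a route through a vertex. This forces the case distinction. -/
theorem edist_edgePoint_le_of_le (e : G.edgeSet) (s t : Icc 0 (ℓ e)) (hst : s ≤ t) :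
    edist (edgePoint ℓ e s) (edgePoint ℓ e t) ≤ ENNReal.ofReal (t - s) := by
  have hst' : (s : ℝ) ≤ t := hst
  rcases hst.eq_or_lt with rfl | hlt
  · simp
  have hlt' : (s : ℝ) < t := hlt
  have hs1 : (s : ℝ) < ℓ e := hlt'.trans_le t.2.2
  have ht0 : 0 < (t : ℝ) := s.2.1.trans_lt hlt'
  by_cases hs : 0 < (s : ℝ)
  · by_cases ht : (t : ℝ) < ℓ e
    · refine (min_le_left _ _).trans ?_
      rw [edgePoint_of_mem_Ioo e ⟨hs, hs1⟩, edgePoint_of_mem_Ioo e ⟨ht0, ht⟩]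
      simp [segmentDist, abs_of_nonpos (sub_nonpos.2 hst')]
    · have h : (t : ℝ) = ℓ e := le_antisymm t.2.2 (not_lt.1 ht)
      refine (edist_le_through _ _ (tgt e) (tgt e)).trans ?_
      have := toVertex_edgePoint_tgt_le e s hs
      have h2 := toVertex_edgePoint_tgt_le e t ht0
      rw [h] at h2 ⊢
      simp only [sub_self, ENNReal.ofReal_zero, nonpos_iff_eq_zero] at h2
      simpa [h2, vertexDist_self] using this
  · have h : (s : ℝ) = 0 := le_antisymm (not_lt.1 hs) s.2.1
    have h1 := toVertex_edgePoint_src_le e s hs1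
    rw [h] at h1 ⊢
    simp only [ENNReal.ofReal_zero, nonpos_iff_eq_zero] at h1
    by_cases ht : (t : ℝ) < ℓ e
    · refine (edist_le_through _ _ (src e) (src e)).trans ?_
      simpa [h1, vertexDist_self] using toVertex_edgePoint_src_le e t ht
    · have h' : (t : ℝ) = ℓ e := le_antisymm t.2.2 (not_lt.1 ht)
      refine (edist_le_through _ _ (src e) (tgt e)).trans ?_
      have h2 := toVertex_edgePoint_tgt_le e t ht0
      rw [h'] at h2 ⊢
      simp only [sub_self, ENNReal.ofReal_zero, nonpos_iff_eq_zero] at h2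
      simpa [h1, h2] using vertexDist_src_tgt ℓ e

theorem edist_edgePoint_le (e : G.edgeSet) (s t : Icc 0 (ℓ e)) :
    edist (edgePoint ℓ e s) (edgePoint ℓ e t) ≤ edist (s : ℝ) t := by
  rw [edist_dist, Real.dist_eq]
  rcases le_total s t with h | h
  · rw [abs_sub_comm, abs_of_nonneg (sub_nonneg.2 (Subtype.coe_le_coe.2 h))]
    exact edist_edgePoint_le_of_le e s t h
  · rw [edist_comm, abs_of_nonneg (sub_nonneg.2 (Subtype.coe_le_coe.2 h))]
    exact edist_edgePoint_le_of_le e t s h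

/-- The distance of a point of an edge of length `L` to the endvertices of the edge. -/
noncomputable def margin (L t : ℝ) : ℝ := min t (L - t)

theorem margin_le_toVertex (e : G.edgeSet) (t : ℝ) (h₀ : 0 < t) (h₁ : t < ℓ e) (a : V) :
    ENNReal.ofReal (margin (ℓ e) t) ≤ toVertex ℓ (.inner e t h₀ h₁) a := by
  simp only [toVertex]
  split_ifs
  · exact ENNReal.ofReal_le_ofReal (min_le_left _ _)
  · exact ENNReal.ofReal_le_ofReal (min_le_right _ _)
  · simp

theorem margin_le_throughDist (e : G.edgeSet) (t : ℝ) (h₀ : 0 < t) (h₁ : t < ℓ e) (q : Point G ℓ) :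
    ENNReal.ofReal (margin (ℓ e) t) ≤ throughDist ℓ (.inner e t h₀ h₁) q :=
  le_iInf₂ fun a _ => (margin_le_toVertex e t h₀ h₁ a).trans
    (le_self_add.trans le_self_add)

theorem margin_add_margin_le_throughDist (e f : G.edgeSet) (s t : ℝ) (hs₀ : 0 < s) (hs₁ : s < ℓ e)
    (ht₀ : 0 < t) (ht₁ : t < ℓ f) :
    ENNReal.ofReal (margin (ℓ e) s) + ENNReal.ofReal (margin (ℓ f) t) ≤
      throughDist ℓ (.inner e s hs₀ hs₁) (.inner f t ht₀ ht₁) :=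
  le_iInf₂ fun a b => add_le_add ((margin_le_toVertex e s hs₀ hs₁ a).trans le_self_add)
    (margin_le_toVertex f t ht₀ ht₁ b)

/-- Any connection leaving the edge first runs to one of its ends and so costs at least the margin.
-/
theorem eq_inner_of_edist_lt {e : G.edgeSet} {s : ℝ} {h₀ : 0 < s} {h₁ : s < ℓ e} {q : Point G ℓ}
    (h : edist (Point.inner e s h₀ h₁) q < ENNReal.ofReal (margin (ℓ e) s)) :
    ∃ (t : ℝ) (ht₀ : 0 < t) (ht₁ : t < ℓ e), q = .inner e t ht₀ ht₁ := by
  rcases min_lt_iff.1 h with h | h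
  · cases q with
    | vertex v => simp [segmentDist] at h
    | inner f t ht₀ ht₁ =>
      by_cases hef : e = f
      · subst hef; exact ⟨t, ht₀, ht₁, rfl⟩
      · simp [segmentDist, hef] at h
  · exact absurd h (margin_le_throughDist e s h₀ h₁ q).not_gt

variable (hℓ : ∀ e, 0 < ℓ e)

/-- The closed edge `e` as a curve in `|G|_ℓ`, extended constantly to the real line. -/
noncomputable def edgeMap (e : G.edgeSet) (t : ℝ) : Space G ℓ :=
  MetricCompletion.of (edgePoint ℓ e (projIcc 0 (ℓ e) (hℓ e).le t))

theorem edgeMap_of_mem (e : G.edgeSet) {t : ℝ} (ht : t ∈ Icc 0 (ℓ e)) :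
    edgeMap hℓ e t = MetricCompletion.of (edgePoint ℓ e ⟨t, ht⟩) := by
  rw [edgeMap, projIcc_of_mem _ ht]

theorem edgeMap_of_mem_Ioo (e : G.edgeSet) {t : ℝ} (ht : t ∈ Ioo 0 (ℓ e)) :
    edgeMap hℓ e t = MetricCompletion.of (.inner e t ht.1 ht.2) := by
  rw [edgeMap_of_mem hℓ e (Ioo_subset_Icc_self ht), edgePoint_of_mem_Ioo e ht]

theorem edgeMap_zero (e : G.edgeSet) :
    edgeMap hℓ e 0 = MetricCompletion.of (.vertex (src e)) := by
  rw [edgeMap_of_mem hℓ e ⟨le_rfl, (hℓ e).le⟩]; simp [edgePoint]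

theorem edgeMap_length (e : G.edgeSet) :
    edgeMap hℓ e (ℓ e) = MetricCompletion.of (.vertex (tgt e)) := by
  rw [edgeMap_of_mem hℓ e ⟨(hℓ e).le, le_rfl⟩]; simp [edgePoint, hℓ e]

theorem mem_edgeTrace {X : Set (Space G ℓ)} {e : G.edgeSet} {t : ℝ} :
    t ∈ edgeTrace ℓ X e ↔ t ∈ Icc 0 (ℓ e) ∧ edgeMap hℓ e t ∈ X :=
  ⟨fun ⟨h, hX⟩ => ⟨h, by rwa [edgeMap_of_mem hℓ e h]⟩,
    fun ⟨h, hX⟩ => ⟨h, by rwa [edgeMap_of_mem hℓ e h] at hX⟩⟩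

theorem edgeTrace_eq (X : Set (Space G ℓ)) (e : G.edgeSet) :
    edgeTrace ℓ X e = Icc 0 (ℓ e) ∩ edgeMap hℓ e ⁻¹' X := by
  ext t; exact mem_edgeTrace hℓ

theorem edgeTrace_mono {X Y : Set (Space G ℓ)} (h : X ⊆ Y) (e : G.edgeSet) :
    edgeTrace ℓ X e ⊆ edgeTrace ℓ Y e := fun _ ⟨ht, hX⟩ => ⟨ht, h hX⟩

theorem lipschitzWith_edgeMap (e : G.edgeSet) : LipschitzWith 1 (edgeMap hℓ e) := fun s t => by
  rw [edgeMap, edgeMap, MetricCompletion.isometry_of.edist_eq]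
  exact (edist_edgePoint_le e _ _).trans ((LipschitzWith.projIcc (hℓ e).le) s t)

theorem continuous_edgeMap (e : G.edgeSet) : Continuous (edgeMap hℓ e) :=
  (lipschitzWith_edgeMap hℓ e).continuous

theorem isCompact_edgeMap_image (e : G.edgeSet) : IsCompact (edgeMap hℓ e '' Icc 0 (ℓ e)) :=
  isCompact_Icc.image (continuous_edgeMap hℓ e)

theorem isClosed_edgeTrace (hℓ : ∀ e, 0 < ℓ e) {X : Set (Space G ℓ)} (hX : IsClosed X) (e : G.edgeSet) :
    IsClosed (edgeTrace ℓ X e) := by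
  rw [edgeTrace_eq hℓ]
  exact isClosed_Icc.inter (hX.preimage (continuous_edgeMap hℓ e))

/-- A connection either stays inside the edge, or leaves it and comes back, paying both margins. -/
theorem min_le_edist_edgeMap (e : G.edgeSet) {s t : ℝ} (hs : s ∈ Ioo 0 (ℓ e))
    (ht : t ∈ Icc 0 (ℓ e)) :
    min (ENNReal.ofReal |s - t|) (ENNReal.ofReal (margin (ℓ e) s) + ENNReal.ofReal (margin (ℓ e) t))
      ≤ edist (edgeMap hℓ e s) (edgeMap hℓ e t) := by
  by_cases ht' : t ∈ Ioo 0 (ℓ e)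
  · rw [edgeMap_of_mem_Ioo hℓ e hs, edgeMap_of_mem_Ioo hℓ e ht',
      MetricCompletion.isometry_of.edist_eq]
    refine min_le_min ?_ (margin_add_margin_le_throughDist e e s t hs.1 hs.2 ht'.1 ht'.2)
    simp [segmentDist]
  -- At an end of the edge the margin vanishes, and a point closer than the margin of `s` would be
  -- an inner point.
  · have hm : ENNReal.ofReal (margin (ℓ e) t) = 0 := by
      rw [ENNReal.ofReal_eq_zero]
      by_contra! h
      exact ht' ⟨(lt_min_iff.1 h).1, sub_pos.1 (lt_min_iff.1 h).2⟩
    rw [hm, add_zero, edgeMap_of_mem_Ioo hℓ e hs, edgeMap_of_mem hℓ e ht,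
      MetricCompletion.isometry_of.edist_eq]
    refine (min_le_right _ _).trans (le_of_not_gt fun h => ?_)
    obtain ⟨r, hr₀, hr₁, hr⟩ := eq_inner_of_edist_lt h
    unfold edgePoint at hr
    split_ifs at hr with h1 h2
    exact ht' ⟨h1, h2⟩

theorem margin_add_margin_le_edist_edgeMap {e f : G.edgeSet} (hef : e ≠ f) {s t : ℝ}
    (hs : s ∈ Ioo 0 (ℓ e)) (ht : t ∈ Ioo 0 (ℓ f)) :
    ENNReal.ofReal (margin (ℓ e) s) + ENNReal.ofReal (margin (ℓ f) t)
      ≤ edist (edgeMap hℓ e s) (edgeMap hℓ f t) := by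
  rw [edgeMap_of_mem_Ioo hℓ e hs, edgeMap_of_mem_Ioo hℓ f ht,
    MetricCompletion.isometry_of.edist_eq]
  refine le_min ?_ (margin_add_margin_le_throughDist e f s t hs.1 hs.2 ht.1 ht.2)
  simp [segmentDist, hef]

theorem exists_eq_edgeMap_of_edist_lt {e : G.edgeSet} {s : ℝ} (hs : s ∈ Ioo 0 (ℓ e))
    {z : Space G ℓ} (hz : edist (edgeMap hℓ e s) z < ENNReal.ofReal (margin (ℓ e) s)) :
    ∃ t ∈ Ioo 0 (ℓ e), z = edgeMap hℓ e t ∧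
      ENNReal.ofReal |s - t| ≤ edist (edgeMap hℓ e s) z := by
  -- The completion adds no points here: those of `G` are dense, the ones close to the given inner
  -- point lie on `e`, and the closed edge is compact, hence closed.
  obtain ⟨t, ht, rfl⟩ : z ∈ edgeMap hℓ e '' Icc 0 (ℓ e) := by
    rw [← (isCompact_edgeMap_image hℓ e).isClosed.closure_eq, mem_closure_iff]
    intro O hO hzO
    have hO' : IsOpen {w | edist (edgeMap hℓ e s) w < ENNReal.ofReal (margin (ℓ e) s)} :=
      isOpen_lt (by fun_prop) continuous_const
    obtain ⟨_, ⟨hqO, hq⟩, q, rfl⟩ := MetricCompletion.denseRange_of.inter_open_nonempty _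
      (hO.inter hO') ⟨z, hzO, hz⟩
    rw [mem_ofPred_eq, edgeMap_of_mem_Ioo hℓ e hs, MetricCompletion.isometry_of.edist_eq] at hq
    obtain ⟨t, h₀, h₁, rfl⟩ := eq_inner_of_edist_lt hq
    exact ⟨_, hqO, t, ⟨h₀.le, h₁.le⟩, edgeMap_of_mem_Ioo hℓ e ⟨h₀, h₁⟩⟩
  have h := (min_le_iff.1 (min_le_edist_edgeMap hℓ e hs ht)).resolve_right
    fun h => (le_self_add.trans h).not_gt hz
  have h2 : |s - t| < margin (ℓ e) s := (ENNReal.ofReal_lt_ofReal_iff'.1 (h.trans_lt hz)).1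
  have h3 := abs_lt.1 h2
  have h4 : margin (ℓ e) s ≤ s := min_le_left _ _
  have h5 : margin (ℓ e) s ≤ ℓ e - s := min_le_right _ _
  exact ⟨t, ⟨by linarith, by linarith⟩, rfl, h⟩

theorem margin_pos {L t : ℝ} (ht : t ∈ Ioo 0 L) : 0 < margin L t :=
  lt_min ht.1 (sub_pos.2 ht.2)

theorem injOn_edgeMap (e : G.edgeSet) : InjOn (edgeMap hℓ e) (Ioo 0 (ℓ e)) := by
  intro s hs t ht hst
  have h := min_le_edist_edgeMap hℓ e hs (Ioo_subset_Icc_self ht)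
  rw [hst, edist_self, min_le_iff] at h
  rcases h with h | h
  · simpa [sub_eq_zero] using h
  · simp [(margin_pos hs).not_ge] at h

theorem isOpen_edgeMap_image (e : G.edgeSet) : IsOpen (edgeMap hℓ e '' Ioo 0 (ℓ e)) := by
  rw [EMetric.isOpen_iff]
  rintro _ ⟨s, hs, rfl⟩
  refine ⟨_, ENNReal.ofReal_pos.2 (margin_pos hs), fun z hz => ?_⟩
  rw [Metric.mem_eball'] at hz
  obtain ⟨t, ht, rfl, -⟩ := exists_eq_edgeMap_of_edist_lt hℓ hs hz
  exact ⟨t, ht, rfl⟩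

theorem isInnerPoint_iff {z : Space G ℓ} :
    IsInnerPoint ℓ z ↔ ∃ e, z ∈ edgeMap hℓ e '' Ioo 0 (ℓ e) := by
  constructor
  · rintro ⟨e, t, h₀, h₁, rfl⟩
    exact ⟨e, t, ⟨h₀, h₁⟩, edgeMap_of_mem_Ioo hℓ e ⟨h₀, h₁⟩⟩
  · rintro ⟨e, t, ht, rfl⟩
    exact ⟨e, t, ht.1, ht.2, edgeMap_of_mem_Ioo hℓ e ht⟩

/-- The coordinate of a point of the open edge `e`. -/
noncomputable def coord (e : G.edgeSet) : Space G ℓ → ℝ :=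
  Function.invFunOn (edgeMap hℓ e) (Ioo 0 (ℓ e))

theorem coord_edgeMap (e : G.edgeSet) {t : ℝ} (ht : t ∈ Ioo 0 (ℓ e)) :
    coord hℓ e (edgeMap hℓ e t) = t :=
  (injOn_edgeMap hℓ e).leftInvOn_invFunOn ht

theorem continuousOn_coord (e : G.edgeSet) :
    ContinuousOn (coord hℓ e) (edgeMap hℓ e '' Ioo 0 (ℓ e)) := by
  rintro _ ⟨s, hs, rfl⟩
  refine ContinuousAt.continuousWithinAt ?_
  rw [ContinuousAt, EMetric.tendsto_nhds]
  intro ε hε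
  filter_upwards [Metric.eball_mem_nhds (edgeMap hℓ e s) (lt_min hε (ENNReal.ofReal_pos.2 (margin_pos hs)))]
    with z hz
  rw [Metric.mem_eball', lt_min_iff] at hz
  obtain ⟨t, ht, rfl, h⟩ := exists_eq_edgeMap_of_edist_lt hℓ hs hz.2
  rw [coord_edgeMap hℓ e hs, coord_edgeMap hℓ e ht, edist_comm, edist_dist, Real.dist_eq]
  exact h.trans_lt hz.1

/-- A curve that is injective near `c` and meets the open edge `e` at the time `c` covers a
neighbourhood of that point in the edge. -/
theorem eventually_edgeMap_mem_image (e : G.edgeSet) {g : ℝ → Space G ℓ} {p q c a : ℝ}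
    (hg : ContinuousOn g (Ioo p q)) (hinj : InjOn g (Ioo p q)) (hc : c ∈ Ioo p q)
    (ha : a ∈ Ioo 0 (ℓ e)) (hca : g c = edgeMap hℓ e a) :
    ∀ᶠ t in 𝓝 a, edgeMap hℓ e t ∈ g '' Ioo p q := by
  have hO : g ⁻¹' (edgeMap hℓ e '' Ioo 0 (ℓ e)) ∈ 𝓝 c :=
    (hg.continuousAt (Ioo_mem_nhds hc.1 hc.2)).preimage_mem_nhds
      ((isOpen_edgeMap_image hℓ e).mem_nhds ⟨a, ha, hca.symm⟩)
  obtain ⟨ε, hε, hball⟩ := Metric.mem_nhds_iff.1 (inter_mem hO (Ioo_mem_nhds hc.1 hc.2))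
  have hsub : Icc (c - ε / 2) (c + ε / 2) ⊆
      g ⁻¹' (edgeMap hℓ e '' Ioo 0 (ℓ e)) ∩ Ioo p q := by
    refine Subset.trans (fun x hx => ?_) hball
    rw [Metric.mem_ball, Real.dist_eq, abs_lt]
    constructor <;> linarith [hx.1, hx.2]
  set k := coord hℓ e ∘ g with hk
  have hkc : ContinuousOn k (Icc (c - ε / 2) (c + ε / 2)) :=
    (continuousOn_coord hℓ e).comp (hg.mono fun x hx => (hsub hx).2) fun x hx => (hsub hx).1
  have hki : InjOn k (Icc (c - ε / 2) (c + ε / 2)) := by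
    intro x hx y hy hxy
    obtain ⟨s, hs, hsx⟩ := (hsub hx).1
    obtain ⟨t, ht, hty⟩ := (hsub hy).1
    simp only [hk, Function.comp_apply, ← hsx, ← hty, coord_edgeMap hℓ e hs, coord_edgeMap hℓ e ht] at hxy
    exact hinj (hsub hx).2 (hsub hy).2 (by rw [← hsx, ← hty, hxy])
  have hkca : k c = a := by simp [hk, hca, coord_edgeMap hℓ e ha]
  have hle : c - ε / 2 ≤ c + ε / 2 := by linarith
  have hmemc : c ∈ Icc (c - ε / 2) (c + ε / 2) := ⟨by linarith, by linarith⟩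
  have key : ∀ t ∈ k '' Icc (c - ε / 2) (c + ε / 2), edgeMap hℓ e t ∈ g '' Ioo p q := by
    rintro _ ⟨x, hx, rfl⟩
    obtain ⟨s, hs, hsx⟩ := (hsub hx).1
    refine ⟨x, (hsub hx).2, ?_⟩
    simp [hk, ← hsx, coord_edgeMap hℓ e hs]
  -- In the edge coordinate the curve is a continuous injective real function, hence strictly
  -- monotone, and by the intermediate value theorem it covers an interval around `a`.
  rcases hkc.strictMonoOn_of_injOn_Icc' hle hki with hm | hm
  · have h1 : k (c - ε / 2) < a := hkca ▸ hm (left_mem_Icc.2 hle) hmemc (by linarith)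
    have h2 : a < k (c + ε / 2) := hkca ▸ hm hmemc (right_mem_Icc.2 hle) (by linarith)
    filter_upwards [Icc_mem_nhds h1 h2] with t ht
    exact key t (intermediate_value_Icc hle hkc ht)
  · have h1 : a < k (c - ε / 2) := hkca ▸ hm (left_mem_Icc.2 hle) hmemc (by linarith)
    have h2 : k (c + ε / 2) < a := hkca ▸ hm hmemc (right_mem_Icc.2 hle) (by linarith)
    filter_upwards [Icc_mem_nhds h2 h1] with t ht
    exact key t (intermediate_value_Icc' hle hkc ht)

end LengthGraph

/-! ### Distances in connected sets are bounded by their total edge measure. -/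

namespace LengthGraph

variable {V : Type*} {G : SimpleGraph V} {ℓ : G.edgeSet → ℝ}

theorem reachable_of_vertexDist_lt_top {u v : V} (h : vertexDist ℓ u v < ⊤) : G.Reachable u v := by
  by_contra hn
  have : IsEmpty (G.Walk u v) := not_nonempty_iff.1 hn
  simp [vertexDist] at h

theorem exists_toVertex_lt_top_of_edist_lt_top {u : V} {p : Point G ℓ}
    (h : edist (Point.vertex u) p < ⊤) : ∃ b, G.Reachable u b ∧ toVertex ℓ p b < ⊤ := by
  have h' : throughDist ℓ (.vertex u) p < ⊤ := by
    rcases min_lt_iff.1 h with h | h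
    · simp [segmentDist] at h
    · exact h
  obtain ⟨a, h'⟩ := iInf_lt_iff.1 h'
  obtain ⟨b, h'⟩ := iInf_lt_iff.1 h'
  rw [ENNReal.add_lt_top, ENNReal.add_lt_top] at h'
  obtain ⟨⟨h1, h2⟩, h3⟩ := h'
  have hau : a = u := by
    by_contra hau
    simp [toVertex, hau] at h1
  subst hau
  exact ⟨b, reachable_of_vertexDist_lt_top h2, h3⟩

theorem reachable_of_edist_vertex_lt_top {u v : V}
    (h : edist (Point.vertex u : Point G ℓ) (.vertex v) < ⊤) : G.Reachable u v := by
  obtain ⟨b, hb, hvb⟩ := exists_toVertex_lt_top_of_edist_lt_top h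
  have hbv : b = v := by
    by_contra hbv
    simp [toVertex, hbv] at hvb
  exact hbv ▸ hb

theorem reachable_src_of_edist_inner_lt_top {u : V} {e : G.edgeSet} {t : ℝ} {h₀ : 0 < t}
    {h₁ : t < ℓ e} (h : edist (Point.vertex u) (Point.inner e t h₀ h₁) < ⊤) :
    G.Reachable u (src e) := by
  obtain ⟨b, hb, hvb⟩ := exists_toVertex_lt_top_of_edist_lt_top h
  simp only [toVertex] at hvb
  split_ifs at hvb with h1 h2
  · exact h1 ▸ hb
  · exact (h2 ▸ hb).trans (adj_src_tgt e).symm.reachable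
  · simp at hvb

theorem exists_edist_vertex_lt_top (hℓ : ∀ e, 0 < ℓ e) (z : Space G ℓ) :
    ∃ v : V, edist (MetricCompletion.of (.vertex v)) z < ⊤ := by
  obtain ⟨_, hq, p, rfl⟩ := MetricCompletion.denseRange_of.inter_open_nonempty
    (Metric.eball z ⊤) Metric.isOpen_eball ⟨z, by simp⟩
  rw [Metric.mem_eball] at hq
  cases p with
  | vertex v => exact ⟨v, hq⟩
  | inner e t h₀ h₁ =>
    refine ⟨src e, (edist_triangle _ _ _).trans_lt (ENNReal.add_lt_top.2 ⟨?_, hq⟩)⟩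
    rw [← edgeMap_zero hℓ e, ← edgeMap_of_mem_Ioo hℓ e ⟨h₀, h₁⟩]
    exact (lipschitzWith_edgeMap hℓ e 0 t).trans_lt (by simp [edist_dist])

theorem countable_edgeSet (hℓ : ∀ e, 0 < ℓ e) (hsum : Summable ℓ) : Countable G.edgeSet := by
  have h := hsum.countable_support
  rwa [Function.support_eq_univ fun e => (hℓ e).ne', countable_univ_iff] at h

theorem tsum_ofReal_ne_top (hℓ : ∀ e, 0 < ℓ e) (hsum : Summable ℓ) :
    ∑' e, ENNReal.ofReal (ℓ e) ≠ ⊤ := by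
  rw [← ENNReal.ofReal_tsum_of_nonneg (fun e => (hℓ e).le) hsum]
  exact ENNReal.ofReal_ne_top

/-- On the line, Lebesgue measure is one-dimensional Hausdorff measure, which 1-Lipschitz maps do
not increase; no measurability is needed. -/
theorem volume_image_le {g : ℝ → ℝ} (hg : LipschitzWith 1 g) (s : Set ℝ) :
    MeasureTheory.volume (g '' s) ≤ MeasureTheory.volume s := by
  have h := hg.hausdorffMeasure_image_le zero_le_one s
  rwa [MeasureTheory.hausdorffMeasure_real, ENNReal.coe_one, ENNReal.one_rpow, one_mul] at h

section ReachableValues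

variable (hℓ : ∀ e, 0 < ℓ e) (f : Space G ℓ → ℝ) (F : Finset G.edgeSet) (v₀ : V)

/-- The vertex `v₀` and the endvertices of the edges in `F`. -/
def baseVertices : Set V := insert v₀ (⋃ e ∈ F, {src e, tgt e})

/-- The values of `f` on the edges outside `F` and on `baseVertices F v₀`. -/
def tailValues : Set ℝ :=
  (⋃ e ∈ {e | e ∉ F}, (f ∘ edgeMap hℓ e) '' Icc 0 (ℓ e)) ∪
    (fun v => f (MetricCompletion.of (.vertex v))) '' baseVertices F v₀

/-- The union of those components of `tailValues` that contain values at base vertices. -/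
def tailComponents : Set ℝ :=
  ⋃ v ∈ baseVertices F v₀, connectedComponentIn (tailValues hℓ f F v₀)
    (f (MetricCompletion.of (.vertex v)))

theorem finite_baseVertices : (baseVertices F v₀).Finite :=
  (F.finite_toSet.biUnion fun e _ => by simp).insert v₀

variable {hℓ f F v₀}

theorem base_mem_tailComponents {v : V} (hv : v ∈ baseVertices F v₀) :
    f (MetricCompletion.of (.vertex v)) ∈ tailComponents hℓ f F v₀ :=
  mem_biUnion hv (mem_connectedComponentIn (Or.inr ⟨v, hv, rfl⟩))

theorem edge_subset_tailComponents (hf : Continuous f) {e : G.edgeSet} (he : e ∉ F) {r : ℝ}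
    (hr : r ∈ Icc 0 (ℓ e)) (h : f (edgeMap hℓ e r) ∈ tailComponents hℓ f F v₀) :
    (f ∘ edgeMap hℓ e) '' Icc 0 (ℓ e) ⊆ tailComponents hℓ f F v₀ := by
  obtain ⟨v, hv, h⟩ := mem_iUnion₂.1 h
  refine Subset.trans ?_ (subset_biUnion_of_mem (u := fun v => connectedComponentIn
    (tailValues hℓ f F v₀) (f (MetricCompletion.of (.vertex v)))) hv)
  rw [connectedComponentIn_eq h]
  refine IsPreconnected.subset_connectedComponentIn ?_ ⟨r, hr, rfl⟩ ?_
  · exact isPreconnected_Icc.image _ (hf.comp (continuous_edgeMap hℓ e)).continuousOn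
  · exact (subset_biUnion_of_mem (u := fun e => (f ∘ edgeMap hℓ e) '' Icc 0 (ℓ e)) he).trans
      subset_union_left

/-- Follow a walk from `v₀`. An edge outside `F` has connected image and stays in the current
component; an edge in `F` may jump, but it ends at a base vertex. -/
theorem vertex_mem_tailComponents (hf : Continuous f) {v : V} (hv : G.Reachable v₀ v) :
    f (MetricCompletion.of (.vertex v)) ∈ tailComponents hℓ f F v₀ := by
  rw [SimpleGraph.reachable_iff_reflTransGen] at hv
  induction hv with
  | refl => exact base_mem_tailComponents (mem_insert _ _)
  | @tail u w _ huw ih =>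
    have h0 : (0 : ℝ) ∈ Icc 0 (ℓ ⟨s(u, w), huw⟩) := left_mem_Icc.2 (hℓ _).le
    have h1 : ℓ ⟨s(u, w), huw⟩ ∈ Icc 0 (ℓ ⟨s(u, w), huw⟩) := right_mem_Icc.2 (hℓ _).le
    have h2 := edgeMap_zero hℓ ⟨s(u, w), huw⟩
    have h3 := edgeMap_length hℓ ⟨s(u, w), huw⟩
    have hends := Sym2.eq_iff.1 (mk_src_tgt (G := G) ⟨s(u, w), huw⟩)
    generalize (⟨s(u, w), huw⟩ : G.edgeSet) = e at *
    by_cases he : e ∈ F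
    · refine base_mem_tailComponents (Or.inr (mem_biUnion he ?_))
      rcases hends with ⟨-, h⟩ | ⟨h, -⟩ <;> simp [h]
    · rcases hends with ⟨ha, hb⟩ | ⟨ha, hb⟩
      · rw [← ha, ← h2] at ih
        rw [← hb, ← h3]
        exact edge_subset_tailComponents hf he h0 ih ⟨_, h1, rfl⟩
      · rw [← hb, ← h3] at ih
        rw [← ha, ← h2]
        exact edge_subset_tailComponents hf he h1 ih ⟨_, h0, rfl⟩

theorem volume_tailValues_le (hf : LipschitzWith 1 f) [Countable G.edgeSet] :
    MeasureTheory.volume (tailValues hℓ f F v₀) ≤ ∑' e : {e // e ∉ F}, ENNReal.ofReal (ℓ e) := by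
  refine (MeasureTheory.measure_union_le _ _).trans ?_
  rw [((finite_baseVertices F v₀).image _).measure_zero, add_zero]
  refine (MeasureTheory.measure_biUnion_le _ (to_countable _) _).trans ?_
  refine ENNReal.tsum_le_tsum fun e => ?_
  have h : LipschitzWith 1 (f ∘ edgeMap hℓ (e : G.edgeSet)) := by
    simpa using hf.comp (lipschitzWith_edgeMap hℓ (e : G.edgeSet))
  exact (volume_image_le h _).trans (by simp)

/-- A finite union of intervals gains only a null set under closure. This is why only the components
at the finitely many base vertices are kept: the closure of all of `tailValues` could be much
larger. -/
theorem volume_closure_tailComponents_le (hf : LipschitzWith 1 f) [Countable G.edgeSet] :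
    MeasureTheory.volume (closure (tailComponents hℓ f F v₀)) ≤
      ∑' e : {e // e ∉ F}, ENNReal.ofReal (ℓ e) := by
  refine le_trans ?_ (volume_tailValues_le (hℓ := hℓ) (v₀ := v₀) hf)
  have hfin := finite_baseVertices (G := G) F v₀
  rw [tailComponents, hfin.closure_biUnion]
  have hsub : (⋃ v ∈ baseVertices F v₀, closure (connectedComponentIn (tailValues hℓ f F v₀)
      (f (MetricCompletion.of (.vertex v))))) ⊆ tailValues hℓ f F v₀ ∪
      ⋃ v ∈ baseVertices F v₀, frontier (connectedComponentIn (tailValues hℓ f F v₀)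
        (f (MetricCompletion.of (.vertex v)))) := by
    refine iUnion₂_subset fun v hv => ?_
    rw [closure_eq_self_union_frontier]
    exact union_subset_union (connectedComponentIn_subset _ _)
      (subset_biUnion_of_mem (u := fun v => frontier (connectedComponentIn (tailValues hℓ f F v₀)
        (f (MetricCompletion.of (.vertex v))))) hv)
  refine (MeasureTheory.measure_mono hsub).trans ((MeasureTheory.measure_union_le _ _).trans ?_)
  rw [(MeasureTheory.measure_biUnion_null_iff hfin.countable).2, add_zero]
  exact fun v _ => Convex.addHaar_frontier _ isPreconnected_connectedComponentIn.ordConnected.convex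

variable (hℓ F) in
-- The points at finite distance from `v₀` and off the edges of `F` form an open set, in which
-- points of `G` are dense; those points are reached from `v₀` by walks, so their values lie in
-- `tailComponents`.
theorem mem_closure_of_edist_lt_top {z : Space G ℓ}
    (hz : edist (MetricCompletion.of (.vertex v₀)) z < ⊤)
    (hzF : ∀ e ∈ F, z ∉ edgeMap hℓ e '' Icc 0 (ℓ e)) (hf : Continuous f) :
    f z ∈ closure (tailComponents hℓ f F v₀) := by
  have hO : IsOpen (Metric.eball (MetricCompletion.of (.vertex v₀)) ⊤ ∩
      (⋃ e ∈ F, edgeMap hℓ e '' Icc 0 (ℓ e))ᶜ) :=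
    Metric.isOpen_eball.inter (F.finite_toSet.isClosed_biUnion fun e _ =>
      (isCompact_edgeMap_image hℓ e).isClosed).isOpen_compl
  have hmem : z ∈ Metric.eball (MetricCompletion.of (.vertex v₀)) ⊤ ∩
      (⋃ e ∈ F, edgeMap hℓ e '' Icc 0 (ℓ e))ᶜ :=
    ⟨Metric.mem_eball'.2 hz, by simpa using hzF⟩
  refine map_mem_closure hf (MetricCompletion.denseRange_of.open_subset_closure_inter hO hmem) ?_
  rintro _ ⟨⟨hp, hpF⟩, p, rfl⟩
  rw [Metric.mem_eball', MetricCompletion.isometry_of.edist_eq] at hp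
  cases p with
  | vertex v => exact vertex_mem_tailComponents hf (reachable_of_edist_vertex_lt_top hp)
  | inner e t h₀ h₁ =>
    rw [← edgeMap_of_mem_Ioo hℓ e ⟨h₀, h₁⟩] at hpF ⊢
    have he : e ∉ F := fun he => hpF (mem_biUnion he ⟨t, ⟨h₀.le, h₁.le⟩, rfl⟩)
    have h := vertex_mem_tailComponents (hℓ := hℓ) (F := F) hf
      (reachable_src_of_edist_inner_lt_top hp)
    rw [← edgeMap_zero hℓ] at h
    exact edge_subset_tailComponents hf he (left_mem_Icc.2 (hℓ _).le) h ⟨t, ⟨h₀.le, h₁.le⟩, rfl⟩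

end ReachableValues

/-- A Lipschitz function maps the points that are not inner points of edges to a null set. -/
theorem volume_image_not_isInnerPoint (hℓ : ∀ e, 0 < ℓ e) (hsum : Summable ℓ)
    {f : Space G ℓ → ℝ} (hf : LipschitzWith 1 f) (v₀ : V) :
    MeasureTheory.volume (f '' {z | ¬ IsInnerPoint ℓ z ∧
      edist (MetricCompletion.of (.vertex v₀)) z < ⊤}) = 0 := by
  have := countable_edgeSet hℓ hsum
  -- The image is bounded by the tail sum for every finite `F`, and these tails tend to `0`.
  refine le_antisymm (ge_of_tendsto' (ENNReal.tendsto_tsum_compl_atTop_zero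
    (tsum_ofReal_ne_top hℓ hsum)) fun F => ?_) zero_le
  have hsub : f '' {z | ¬ IsInnerPoint ℓ z ∧ edist (MetricCompletion.of (.vertex v₀)) z < ⊤} ⊆
      closure (tailComponents hℓ f F v₀) := by
    rintro _ ⟨z, ⟨hz, hzv⟩, rfl⟩
    by_cases hzF : ∀ e ∈ F, z ∉ edgeMap hℓ e '' Icc 0 (ℓ e)
    · exact mem_closure_of_edist_lt_top hℓ F hzv hzF hf.continuous
    · push Not at hzF
      obtain ⟨e, he, t, ht, rfl⟩ := hzF
      refine subset_closure ?_
      rw [isInnerPoint_iff hℓ] at hz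
      rcases ht.1.eq_or_lt with rfl | h0
      · rw [edgeMap_zero]
        exact base_mem_tailComponents (Or.inr (mem_biUnion he (by simp)))
      · rcases ht.2.eq_or_lt with rfl | h1
        · rw [edgeMap_length]
          exact base_mem_tailComponents (Or.inr (mem_biUnion he (by simp)))
        · exact absurd ⟨e, t, ⟨h0, h1⟩, rfl⟩ hz
  exact (MeasureTheory.measure_mono hsub).trans (volume_closure_tailComponents_le hf)

/-- The total length of the parts of the edges that lie in `X`. -/
noncomputable def traceLength (ℓ : G.edgeSet → ℝ) (X : Set (Space G ℓ)) : ℝ≥0∞ :=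
  ∑' e, MeasureTheory.volume (edgeTrace ℓ X e)

theorem volume_edgeTrace_le (X : Set (Space G ℓ)) (e : G.edgeSet) :
    MeasureTheory.volume (edgeTrace ℓ X e) ≤ ENNReal.ofReal (ℓ e) := by
  have hsub : edgeTrace ℓ X e ⊆ Icc 0 (ℓ e) := fun _ ⟨h, _⟩ => h
  simpa using MeasureTheory.measure_mono (μ := MeasureTheory.volume) hsub

theorem traceLength_ne_top (hℓ : ∀ e, 0 < ℓ e) (hsum : Summable ℓ) (X : Set (Space G ℓ)) :
    traceLength ℓ X ≠ ⊤ :=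
  ne_top_of_le_ne_top (tsum_ofReal_ne_top hℓ hsum)
    (ENNReal.tsum_le_tsum fun e => volume_edgeTrace_le X e)

/-- The truncated distance from `x`, a real-valued Lipschitz function. -/
theorem lipschitzWith_min_edist {X : Type*} [PseudoEMetricSpace X] (x : X) {M : ℝ≥0∞}
    (hM : M ≠ ⊤) : LipschitzWith 1 fun z => (min M (edist x z)).toReal := by
  refine LipschitzWith.of_edist_le fun y z => ?_
  have key : ∀ y z, (min M (edist x y)).toReal - (min M (edist x z)).toReal ≤
      (min M (edist y z)).toReal := fun y z => by
    have hy : ∀ w : ℝ≥0∞, min M w ≠ ⊤ := fun w => ne_top_of_le_ne_top hM (min_le_left _ _)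
    rw [sub_le_iff_le_add, ← ENNReal.toReal_add (hy _) (hy _),
      ENNReal.toReal_le_toReal (hy _) (ENNReal.add_ne_top.2 ⟨hy _, hy _⟩), min_add, add_min, add_min]
    refine le_min (le_min ?_ ?_) (le_min ?_ ?_)
    · exact (min_le_left _ _).trans le_self_add
    · exact (min_le_left _ _).trans le_self_add
    · exact (min_le_left _ _).trans le_add_self
    · refine (min_le_right _ _).trans ((edist_triangle x z y).trans ?_)
      rw [edist_comm z y, add_comm]
  rw [edist_dist, Real.dist_eq]
  refine (ENNReal.ofReal_le_ofReal (abs_sub_le_iff.2 ⟨key y z, ?_⟩)).trans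
    (ENNReal.ofReal_toReal_le.trans (min_le_right _ _))
  rw [edist_comm y z]; exact key z y

/-- Two points of a connected set are no further apart than the total length of its edge parts. -/
theorem edist_le_traceLength (hℓ : ∀ e, 0 < ℓ e) (hsum : Summable ℓ) {K : Set (Space G ℓ)}
    (hK : IsPreconnected K) {x y : Space G ℓ} (hx : x ∈ K) (hy : y ∈ K) :
    edist x y ≤ traceLength ℓ K := by
  have := countable_edgeSet hℓ hsum
  obtain ⟨v₀, hv₀⟩ := exists_edist_vertex_lt_top hℓ x
  -- Balls of radius `⊤` are clopen, so a connected set cannot contain points at infinite distance.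
  have hKv : K ⊆ Metric.eball (MetricCompletion.of (.vertex v₀)) ⊤ :=
    hK.subset_isClopen ⟨Metric.isClosed_eball_top, Metric.isOpen_eball⟩
      ⟨x, hx, Metric.mem_eball'.2 hv₀⟩
  have hxy : edist x y ≠ ⊤ := by
    refine ((edist_triangle_left x y (MetricCompletion.of (.vertex v₀))).trans_lt
      (ENNReal.add_lt_top.2 ⟨hv₀, Metric.mem_eball'.1 (hKv hy)⟩)).ne
  -- Truncating at `edist x y` keeps the function real-valued on the whole space and does not affect
  -- its values at `x` and `y`.
  set f : Space G ℓ → ℝ := fun z => (min (edist x y) (edist x z)).toReal with hfdef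
  have hf : LipschitzWith 1 f := lipschitzWith_min_edist x hxy
  have hIcc : Icc 0 (edist x y).toReal ⊆ f '' K :=
    ((hK.image f hf.continuous.continuousOn).ordConnected).out
      (show (0 : ℝ) ∈ f '' K from ⟨x, hx, by simp [hfdef]⟩) ⟨y, hy, by simp [hfdef]⟩
  have hcover : f '' K ⊆ f '' {z | ¬ IsInnerPoint ℓ z ∧
      edist (MetricCompletion.of (.vertex v₀)) z < ⊤} ∪
      ⋃ e, (f ∘ edgeMap hℓ e) '' edgeTrace ℓ K e := by
    rintro _ ⟨z, hz, rfl⟩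
    by_cases hin : IsInnerPoint ℓ z
    · obtain ⟨e, t, ht, rfl⟩ := (isInnerPoint_iff hℓ).1 hin
      exact Or.inr (mem_iUnion.2 ⟨e, t, (mem_edgeTrace hℓ).2 ⟨Ioo_subset_Icc_self ht, hz⟩, rfl⟩)
    · exact Or.inl ⟨z, ⟨hin, Metric.mem_eball'.1 (hKv hz)⟩, rfl⟩
  calc edist x y = MeasureTheory.volume (Icc 0 (edist x y).toReal) := by
        rw [Real.volume_Icc, sub_zero, ENNReal.ofReal_toReal hxy]
    _ ≤ _ := MeasureTheory.measure_mono (hIcc.trans hcover)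
    _ ≤ _ := MeasureTheory.measure_union_le _ _
    _ = MeasureTheory.volume (⋃ e, (f ∘ edgeMap hℓ e) '' edgeTrace ℓ K e) := by
        rw [volume_image_not_isInnerPoint hℓ hsum hf v₀, zero_add]
    _ ≤ _ := MeasureTheory.measure_iUnion_le _
    _ ≤ traceLength ℓ K := ENNReal.tsum_le_tsum fun e => volume_image_le
        (by simpa using hf.comp (lipschitzWith_edgeMap hℓ e)) _

end LengthGraph

/-! ### The length of a path equals the total edge measure of its image. -/

namespace LengthGraph

variable {V : Type*} {G : SimpleGraph V} {ℓ : G.edgeSet → ℝ}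

theorem margin_le_of_mem_Icc {L η t : ℝ} (ht : t ∈ Icc η (L - η)) : η ≤ margin L t :=
  le_min ht.1 (by linarith [ht.2])

/-- A set of small diameter meets the cores of the edges in total measure at most its diameter. -/
theorem sum_volume_core_le_ediam (hℓ : ∀ e, 0 < ℓ e) {η : ℝ} (hη : 0 < η) (F : Finset G.edgeSet)
    {A : Set (Space G ℓ)} (hA : Metric.ediam A < ENNReal.ofReal η) :
    ∑ e ∈ F, MeasureTheory.volume (Icc η (ℓ e - η) ∩ edgeMap hℓ e ⁻¹' A) ≤ Metric.ediam A := by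
  have hsub : ∀ {e : G.edgeSet} {t : ℝ}, t ∈ Icc η (ℓ e - η) → t ∈ Ioo 0 (ℓ e) := fun ht =>
    ⟨hη.trans_le ht.1, by linarith [ht.2]⟩
  have hone : ∀ e, MeasureTheory.volume (Icc η (ℓ e - η) ∩ edgeMap hℓ e ⁻¹' A) ≤ Metric.ediam A := by
    refine fun e => (Real.volume_le_diam _).trans (Metric.ediam_le fun s hs t ht => ?_)
    have h : edist (edgeMap hℓ e s) (edgeMap hℓ e t) ≤ Metric.ediam A :=
      Metric.edist_le_ediam_of_mem hs.2 ht.2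
    -- Leaving the edge from its core costs at least `η`, more than the diameter of `A`, so the
    -- distance is at least `|s - t|`.
    have h2 := (min_le_iff.1 ((min_le_edist_edgeMap hℓ e (hsub hs.1)
      (Ioo_subset_Icc_self (hsub ht.1))).trans h)).resolve_right fun h3 => ?_
    · rwa [edist_dist, Real.dist_eq]
    · refine (le_self_add.trans h3).not_gt (hA.trans_le (ENNReal.ofReal_le_ofReal ?_))
      exact margin_le_of_mem_Icc hs.1
  by_cases hex : ∃ e ∈ F, (Icc η (ℓ e - η) ∩ edgeMap hℓ e ⁻¹' A).Nonempty
  · obtain ⟨e, he, s, hs⟩ := hex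
    -- Cores of different edges are too far apart for `A` to meet two of them.
    rw [Finset.sum_eq_single_of_mem e he]
    · exact hone e
    · intro f _ hfe
      suffices Icc η (ℓ f - η) ∩ edgeMap hℓ f ⁻¹' A = ∅ by rw [this, MeasureTheory.measure_empty]
      refine eq_empty_of_forall_notMem fun t ht => ?_
      have h := (margin_add_margin_le_edist_edgeMap hℓ hfe (hsub ht.1) (hsub hs.1)).trans
        (Metric.edist_le_ediam_of_mem ht.2 hs.2)
      exact (le_self_add.trans h).not_gt
        (hA.trans_le (ENNReal.ofReal_le_ofReal (margin_le_of_mem_Icc ht.1)))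
  · push Not at hex
    rw [Finset.sum_eq_zero fun e he => by rw [hex e he, MeasureTheory.measure_empty]]
    exact zero_le

theorem exists_subdivision {X : Type*} [PseudoEMetricSpace X] {γ : unitInterval → X}
    (hγ : Continuous γ) {ε : ℝ≥0∞} (hε : 0 < ε) :
    ∃ (n : ℕ) (I : ℕ → unitInterval), Monotone I ∧ I 0 = 0 ∧ I n = 1 ∧
      ∀ i, Metric.ediam (γ '' Icc (I i) (I (i + 1))) < ε := by
  obtain ⟨ε', hε', hεε'⟩ := exists_between hε
  obtain ⟨δ, hδ, h⟩ := EMetric.uniformContinuous_iff.1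
    (CompactSpace.uniformContinuous_of_continuous hγ) ε' hε'
  obtain ⟨r, hr, hrδ⟩ : ∃ r : ℝ, 0 < r ∧ ENNReal.ofReal r < δ := by
    obtain ⟨r, hr, hrδ⟩ := ENNReal.lt_iff_exists_nnreal_btwn.1 hδ
    exact ⟨r, by simpa using hr, by simpa using hrδ⟩
  obtain ⟨n, hn⟩ := exists_nat_one_div_lt hr
  -- Clipping `i / (n + 1)` to `[0, 1]` makes the mesh bound hold for every `i`, the intervals being
  -- degenerate from `n + 1` on.
  refine ⟨n + 1, fun i => projIcc 0 1 zero_le_one ((i : ℝ) / (n + 1)), fun i j hij =>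
    monotone_projIcc _ (by gcongr), by simp, ?_, fun i => lt_of_le_of_lt ?_ hεε'⟩
  · refine projIcc_of_right_le _ (le_of_eq ?_)
    push_cast
    field_simp
  · refine Metric.ediam_le ?_
    rintro _ ⟨s, hs, rfl⟩ _ ⟨t, ht, rfl⟩
    refine (h (lt_of_le_of_lt ?_ hrδ)).le
    have hmesh : ((projIcc (0 : ℝ) 1 zero_le_one (((i + 1 : ℕ) : ℝ) / (n + 1)) : unitInterval) : ℝ) -
        (projIcc (0 : ℝ) 1 zero_le_one ((i : ℝ) / (n + 1)) : unitInterval) ≤ r := by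
      have h1 := (LipschitzWith.projIcc (zero_le_one (α := ℝ))).dist_le_mul
        (((i + 1 : ℕ) : ℝ) / (n + 1)) ((i : ℝ) / (n + 1))
      rw [Subtype.dist_eq, Real.dist_eq, Real.dist_eq] at h1
      refine (le_abs_self _).trans (h1.trans ?_)
      have : (((i + 1 : ℕ) : ℝ) / (n + 1)) - ((i : ℝ) / (n + 1)) = 1 / (n + 1) := by
        push_cast; ring
      rw [this, abs_of_nonneg (by positivity)]
      simpa using hn.le
    have h1 : (projIcc (0 : ℝ) 1 zero_le_one ((i : ℝ) / (n + 1)) : ℝ) ≤ s := hs.1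
    have h2 : (s : ℝ) ≤ (projIcc (0 : ℝ) 1 zero_le_one (((i + 1 : ℕ) : ℝ) / (n + 1)) : ℝ) := hs.2
    have h3 : (projIcc (0 : ℝ) 1 zero_le_one ((i : ℝ) / (n + 1)) : ℝ) ≤ t := ht.1
    have h4 : (t : ℝ) ≤ (projIcc (0 : ℝ) 1 zero_le_one (((i + 1 : ℕ) : ℝ) / (n + 1)) : ℝ) := ht.2
    rw [edist_dist, Subtype.dist_eq, Real.dist_eq]
    exact ENNReal.ofReal_le_ofReal (abs_sub_le_iff.2 ⟨by linarith, by linarith⟩)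

theorem sum_volume_core_le_pathLength (hℓ : ∀ e, 0 < ℓ e) {η : ℝ} (hη : 0 < η)
    (F : Finset G.edgeSet) {γ : unitInterval → Space G ℓ} (hγ : Continuous γ) :
    ∑ e ∈ F, MeasureTheory.volume (Icc η (ℓ e - η) ∩ edgeMap hℓ e ⁻¹' range γ) ≤ pathLength γ := by
  obtain ⟨n, I, hI, hI0, hIn, hd⟩ := exists_subdivision hγ (ENNReal.ofReal_pos.2 hη)
  have hcov : range γ ⊆ ⋃ i ∈ Finset.range n, γ '' Icc (I i) (I (i + 1)) := by
    rintro _ ⟨t, rfl⟩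
    -- The half-open intervals used for the covering miss the time `0`.
    rcases eq_or_lt_of_le (unitInterval.nonneg' (t := t)) with h0 | h0
    · have hn : n ≠ 0 := by rintro rfl; simp [hI0] at hIn
      exact mem_biUnion (x := 0) (Finset.mem_range.2 (Nat.pos_of_ne_zero hn))
        ⟨t, ⟨by rw [hI0]; exact unitInterval.nonneg', by rw [← h0]; exact unitInterval.nonneg'⟩, rfl⟩
    · have hmem : t ∈ Ioc (I 0) (I n) := by
        rw [hI0, hIn]; exact ⟨h0, unitInterval.le_one'⟩
      rw [← hI.biUnion_Ico_Ioc_map_succ 0 n] at hmem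
      obtain ⟨i, hi, hti⟩ := mem_iUnion₂.1 hmem
      exact mem_biUnion (x := i) (Finset.mem_range.2 hi.2) ⟨t, Ioc_subset_Icc_self hti, rfl⟩
  calc ∑ e ∈ F, MeasureTheory.volume (Icc η (ℓ e - η) ∩ edgeMap hℓ e ⁻¹' range γ)
      ≤ ∑ e ∈ F, ∑ i ∈ Finset.range n, MeasureTheory.volume
          (Icc η (ℓ e - η) ∩ edgeMap hℓ e ⁻¹' (γ '' Icc (I i) (I (i + 1)))) := by
        refine Finset.sum_le_sum fun e _ => ?_
        refine (MeasureTheory.measure_mono ?_).trans (MeasureTheory.measure_biUnion_finset_le _ _)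
        rintro t ⟨ht, hte⟩
        obtain ⟨i, hi, h⟩ := mem_iUnion₂.1 (hcov hte)
        exact mem_biUnion hi ⟨ht, h⟩
    _ = ∑ i ∈ Finset.range n, ∑ e ∈ F, MeasureTheory.volume
          (Icc η (ℓ e - η) ∩ edgeMap hℓ e ⁻¹' (γ '' Icc (I i) (I (i + 1)))) := Finset.sum_comm
    _ ≤ ∑ i ∈ Finset.range n, Metric.ediam (γ '' Icc (I i) (I (i + 1))) :=
        Finset.sum_le_sum fun i _ => sum_volume_core_le_ediam hℓ hη F (hd i)
    _ ≤ ∑ i ∈ Finset.range n, eVariationOn γ (Icc (I i) (I (i + 1))) := by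
        refine Finset.sum_le_sum fun i _ => Metric.ediam_le ?_
        rintro _ ⟨s, hs, rfl⟩ _ ⟨t, ht, rfl⟩
        exact eVariationOn.edist_le γ hs ht
    _ = eVariationOn γ (Icc (I 0) (I n)) := eVariationOn.sum' γ hI
    _ ≤ pathLength γ := eVariationOn.mono γ (subset_univ _)

/-- Finitely many edges suffice for the supremum; for these, restricting to the cores loses at most
`2 * η` per edge, which vanishes as `η` tends to `0`. -/
theorem traceLength_range_le_pathLength (hℓ : ∀ e, 0 < ℓ e)
    {γ : unitInterval → Space G ℓ} (hγ : Continuous γ) :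
    traceLength ℓ (range γ) ≤ pathLength γ := by
  rw [traceLength, ENNReal.tsum_eq_iSup_sum]
  refine iSup_le fun F => ?_
  have hlim : Tendsto (fun η : ℝ => pathLength γ + F.card * ENNReal.ofReal (2 * η)) (𝓝[>] 0)
      (𝓝 (pathLength γ)) := by
    have h : Tendsto (fun η : ℝ => (F.card : ℝ≥0∞) * ENNReal.ofReal (2 * η)) (𝓝[>] 0) (𝓝 0) := by
      have h1 : Tendsto (fun η : ℝ => ENNReal.ofReal (2 * η)) (𝓝[>] 0) (𝓝 0) := by
        have h2 : Continuous fun η : ℝ => ENNReal.ofReal (2 * η) :=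
          ENNReal.continuous_ofReal.comp (by fun_prop)
        simpa using (h2.tendsto 0).mono_left nhdsWithin_le_nhds
      simpa using ENNReal.Tendsto.const_mul h1 (Or.inr (ENNReal.natCast_ne_top F.card))
    simpa using tendsto_const_nhds.add h
  refine ge_of_tendsto hlim (eventually_mem_nhdsWithin.mono fun η (hη : 0 < η) => ?_)
  calc ∑ e ∈ F, MeasureTheory.volume (edgeTrace ℓ (range γ) e)
      ≤ ∑ e ∈ F, (MeasureTheory.volume (Icc η (ℓ e - η) ∩ edgeMap hℓ e ⁻¹' range γ) +
          ENNReal.ofReal (2 * η)) := by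
        refine Finset.sum_le_sum fun e _ => ?_
        have hsub : edgeTrace ℓ (range γ) e ⊆ (Icc η (ℓ e - η) ∩ edgeMap hℓ e ⁻¹' range γ) ∪
            (Icc 0 η ∪ Icc (ℓ e - η) (ℓ e)) := by
          intro t ht
          obtain ⟨⟨h0, h1⟩, h⟩ := (mem_edgeTrace hℓ).1 ht
          by_cases ha : η ≤ t
          · by_cases hb : t ≤ ℓ e - η
            · exact Or.inl ⟨⟨ha, hb⟩, h⟩
            · exact Or.inr (Or.inr ⟨(not_le.1 hb).le, h1⟩)
          · exact Or.inr (Or.inl ⟨h0, (not_le.1 ha).le⟩)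
        refine (MeasureTheory.measure_mono hsub).trans ((MeasureTheory.measure_union_le _ _).trans ?_)
        gcongr
        refine (MeasureTheory.measure_union_le _ _).trans (le_of_eq ?_)
        rw [Real.volume_Icc, Real.volume_Icc, ← ENNReal.ofReal_add (by linarith) (by linarith)]
        congr 1; ring
    _ = ∑ e ∈ F, MeasureTheory.volume (Icc η (ℓ e - η) ∩ edgeMap hℓ e ⁻¹' range γ) +
          F.card * ENNReal.ofReal (2 * η) := by
        rw [Finset.sum_add_distrib, Finset.sum_const, nsmul_eq_mul]
    _ ≤ _ := by
        gcongr
        exact sum_volume_core_le_pathLength hℓ hη F hγ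

theorem traceLength_mono {X Y : Set (Space G ℓ)} (h : X ⊆ Y) :
    traceLength ℓ X ≤ traceLength ℓ Y :=
  ENNReal.tsum_le_tsum fun e => MeasureTheory.measure_mono (edgeTrace_mono h e)

theorem countable_edgeTrace (hℓ : ∀ e, 0 < ℓ e) {X : Set (Space G ℓ)} (hX : X.Countable)
    (e : G.edgeSet) : (edgeTrace ℓ X e).Countable := by
  have hsub : edgeTrace ℓ X e ⊆ {0, ℓ e} ∪ (Ioo 0 (ℓ e) ∩ edgeMap hℓ e ⁻¹' X) := by
    intro t ht
    obtain ⟨⟨h0, h1⟩, h⟩ := (mem_edgeTrace hℓ).1 ht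
    rcases h0.eq_or_lt with rfl | h0
    · simp
    rcases h1.eq_or_lt with rfl | h1
    · simp
    exact Or.inr ⟨⟨h0, h1⟩, h⟩
  refine ((to_countable _).union ?_).mono hsub
  exact MapsTo.countable_of_injOn (f := edgeMap hℓ e) (t := X) (fun t ht => ht.2)
    ((injOn_edgeMap hℓ e).mono inter_subset_left) hX

theorem traceLength_add_le (hℓ : ∀ e, 0 < ℓ e) {A B : Set (Space G ℓ)} (hB : IsClosed B)
    (hAB : (A ∩ B).Countable) :
    traceLength ℓ A + traceLength ℓ B ≤ traceLength ℓ (A ∪ B) := by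
  rw [traceLength, traceLength, ← ENNReal.tsum_add]
  refine ENNReal.tsum_le_tsum fun e => ?_
  rw [← MeasureTheory.measure_union_add_inter _ (isClosed_edgeTrace hℓ hB e).measurableSet]
  have h0 : MeasureTheory.volume (edgeTrace ℓ A e ∩ edgeTrace ℓ B e) = 0 := by
    refine MeasureTheory.measure_mono_null ?_ ((countable_edgeTrace hℓ hAB e).measure_zero _)
    rintro t ⟨⟨ht, hA⟩, ⟨_, hB⟩⟩
    exact ⟨ht, hA, hB⟩
  rw [h0, add_zero]
  exact MeasureTheory.measure_mono (union_subset (edgeTrace_mono subset_union_left e)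
    (edgeTrace_mono subset_union_right e))

/-- Injectivity on the open interval leaves `γ 0` and `γ 1` unrestricted, so besides `γ s` these two
points may be shared. -/
theorem countable_image_inter_image {X : Type*} {γ : unitInterval → X} (hγ : InjOn γ (Ioo 0 1))
    (s t : unitInterval) : (γ '' Icc 0 s ∩ γ '' Icc s t).Countable := by
  refine (to_countable {γ 0, γ s, γ 1}).mono ?_
  rintro _ ⟨⟨u, hu, rfl⟩, ⟨v, hv, hvu⟩⟩
  rcases hu.1.eq_or_lt with rfl | hu0
  · simp
  rcases (unitInterval.le_one' (t := v)).eq_or_lt with rfl | hv1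
  · simp [hvu]
  rcases hu.2.eq_or_lt with rfl | hus
  · simp
  have huv : u < v := hus.trans_le hv.1
  exact absurd (hγ ⟨hu0.trans huv, hv1⟩ ⟨hu0, huv.trans hv1⟩ hvu) huv.ne'

theorem eVariationOn_le_of_edist_le {α E E' : Type*} [LinearOrder α] [PseudoEMetricSpace E]
    [PseudoEMetricSpace E'] {f : α → E} {g : α → E'} {s : Set α}
    (h : ∀ x ∈ s, ∀ y ∈ s, x ≤ y → edist (f x) (f y) ≤ edist (g x) (g y)) :
    eVariationOn f s ≤ eVariationOn g s := by
  refine iSup_le fun p => le_trans (Finset.sum_le_sum fun i _ => ?_)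
    (eVariationOn.sum_le p.2.2.1 p.2.2.2)
  rw [edist_comm, edist_comm (g _)]
  exact h _ (p.2.2.2 _) _ (p.2.2.2 _) (p.2.2.1 (Nat.le_succ i))

theorem pathLength_le_traceLength_range (hℓ : ∀ e, 0 < ℓ e) (hsum : Summable ℓ)
    {γ : unitInterval → Space G ℓ} (hγ : Continuous γ) (hinj : InjOn γ (Ioo 0 1)) :
    pathLength γ ≤ traceLength ℓ (range γ) := by
  -- The edge measure covered up to time `t` serves as a monotone clock dominating all distances
  -- along `γ`; the variation of a monotone function is its total increase.
  set w : unitInterval → ℝ := fun t => (traceLength ℓ (γ '' Icc 0 t)).toReal with hw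
  have hfin := traceLength_ne_top (G := G) hℓ hsum
  have hmono : Monotone w := fun s t hst => ENNReal.toReal_mono (hfin _)
    (traceLength_mono (image_mono (Icc_subset_Icc_right hst)))
  have hle : ∀ x ∈ (univ : Set unitInterval), ∀ y ∈ (univ : Set unitInterval), x ≤ y →
      edist (γ x) (γ y) ≤ edist (w x) (w y) := by
    intro s _ t _ hst
    have hcl : IsClosed (γ '' Icc s t) := (isCompact_Icc.image hγ).isClosed
    have h1 := traceLength_add_le hℓ hcl (countable_image_inter_image hinj s t)
    rw [← image_union, Icc_union_Icc_eq_Icc unitInterval.nonneg' hst] at h1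
    have h2 : edist (γ s) (γ t) ≤ traceLength ℓ (γ '' Icc s t) :=
      edist_le_traceLength hℓ hsum (isPreconnected_Icc.image _ hγ.continuousOn)
        ⟨s, left_mem_Icc.2 hst, rfl⟩ ⟨t, right_mem_Icc.2 hst, rfl⟩
    refine h2.trans ?_
    rw [edist_comm, edist_dist, Real.dist_eq, abs_of_nonneg (sub_nonneg.2 (hmono hst))]
    refine ENNReal.le_ofReal_iff_toReal_le (hfin _) (sub_nonneg.2 (hmono hst)) |>.2 ?_
    rw [le_sub_iff_add_le', hw, ← ENNReal.toReal_add (hfin _) (hfin _)]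
    exact ENNReal.toReal_mono (hfin _) h1
  have hIcc : (univ : Set unitInterval) ∩ Icc 0 1 = univ := by
    rw [univ_inter]; exact eq_univ_of_forall fun t => ⟨unitInterval.nonneg', unitInterval.le_one'⟩
  calc pathLength γ ≤ eVariationOn w univ := eVariationOn_le_of_edist_le hle
    _ = ENNReal.ofReal (w 1 - w 0) := by
        rw [← (hmono.monotoneOn univ).eVariationOn_eq (mem_univ 0) (mem_univ 1), hIcc]
    _ ≤ ENNReal.ofReal (w 1) := ENNReal.ofReal_le_ofReal (sub_le_self _ ENNReal.toReal_nonneg)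
    _ ≤ traceLength ℓ (γ '' Icc 0 1) := ENNReal.ofReal_toReal_le
    _ ≤ _ := traceLength_mono (image_subset_range _ _)

theorem pathLength_eq_traceLength (hℓ : ∀ e, 0 < ℓ e) (hsum : Summable ℓ) {C : Set (Space G ℓ)}
    {γ : unitInterval → Space G ℓ} (hγ : IsParametrization C γ) :
    pathLength γ = traceLength ℓ C := by
  rw [← hγ.range_eq]
  exact (pathLength_le_traceLength_range hℓ hsum hγ.continuous hγ.injOn).antisymm
    (traceLength_range_le_pathLength hℓ hγ.continuous)

end LengthGraph

/-! ### Measure of a subset of the line as the sum over its components. -/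

section MaximalConnected

/-- The maximal connected subsets of `T`. -/
def maximalConnected (T : Set ℝ) : Set (Set ℝ) := {J | Maximal (fun J => IsConnected J ∧ J ⊆ T) J}

theorem mem_maximalConnected {T J : Set ℝ} :
    J ∈ maximalConnected T ↔ Maximal (fun J => IsConnected J ∧ J ⊆ T) J := Iff.rfl

theorem connectedComponentIn_mem_maximalConnected {T : Set ℝ} {t : ℝ} (ht : t ∈ T) :
    connectedComponentIn T t ∈ maximalConnected T :=
  ⟨⟨isConnected_connectedComponentIn_iff.2 ht, connectedComponentIn_subset T t⟩,
    fun _ hJ hle => hJ.1.isPreconnected.subset_connectedComponentIn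
      (hle (mem_connectedComponentIn ht)) hJ.2⟩

theorem pairwiseDisjoint_maximalConnected (T : Set ℝ) :
    (maximalConnected T).PairwiseDisjoint id := by
  intro J hJ K hK hne
  rw [mem_maximalConnected] at hJ hK
  by_contra hd
  have hn : (J ∩ K).Nonempty := not_disjoint_iff_nonempty_inter.1 hd
  have hu : IsConnected (J ∪ K) ∧ J ∪ K ⊆ T :=
    ⟨IsConnected.union hn hJ.prop.1 hK.prop.1, union_subset hJ.prop.2 hK.prop.2⟩
  exact hne ((hJ.eq_of_subset hu subset_union_left).trans
    (hK.eq_of_subset hu subset_union_right).symm)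

/-- One inequality is disjointness of the components. For the other, components through rational
points already cover `interior T`; there are only countably many of them, so subadditivity applies.
-/
theorem tsum_volume_maximalConnected {T : Set ℝ}
    (hT : MeasureTheory.volume (T \ interior T) = 0) :
    ∑' J : maximalConnected T, MeasureTheory.volume (J : Set ℝ) = MeasureTheory.volume T := by
  apply le_antisymm
  · have hmax : ∀ J : maximalConnected T, Maximal (fun J => IsConnected J ∧ J ⊆ T) (J : Set ℝ) :=
      fun J => J.2
    have hdisj : Pairwise (Function.onFun Disjoint fun J : maximalConnected T => (J : Set ℝ)) :=
      fun J K hne => pairwiseDisjoint_maximalConnected T J.2 K.2 (Subtype.coe_injective.ne hne)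
    exact (MeasureTheory.tsum_meas_le_meas_iUnion_of_disjoint _
      (fun J => (hmax J).prop.1.isPreconnected.ordConnected.measurableSet) hdisj).trans
      (MeasureTheory.measure_mono (iUnion_subset fun J => (hmax J).prop.2))
  · have hQ : ((fun q : ℚ => connectedComponentIn T q) '' {q | (q : ℝ) ∈ T}).Countable :=
      (to_countable _).image _
    set Q := (fun q : ℚ => connectedComponentIn T q) '' {q | (q : ℝ) ∈ T}
    have hQT : Q ⊆ maximalConnected T := by
      rintro _ ⟨q, hq, rfl⟩
      exact connectedComponentIn_mem_maximalConnected hq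
    have hint : interior T ⊆ ⋃ J ∈ Q, J := by
      intro t ht
      obtain ⟨ε, hε, hball⟩ := Metric.mem_nhds_iff.1 (mem_interior_iff_mem_nhds.1 ht)
      obtain ⟨q, hq⟩ := Rat.denseRange_cast.exists_dist_lt t hε
      have hqb : (q : ℝ) ∈ Metric.ball t ε := Metric.mem_ball'.2 hq
      refine mem_biUnion ⟨q, hball hqb, rfl⟩ ?_
      exact (convex_ball t ε).isPreconnected.subset_connectedComponentIn hqb hball
        (Metric.mem_ball_self hε)
    calc MeasureTheory.volume T ≤ MeasureTheory.volume (T \ interior T) +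
          MeasureTheory.volume (interior T) :=
          (MeasureTheory.measure_mono (by rw [sdiff_union_self]; exact subset_union_left)).trans
            (MeasureTheory.measure_union_le _ _)
      _ = MeasureTheory.volume (interior T) := by rw [hT, zero_add]
      _ ≤ _ := MeasureTheory.measure_mono hint
      _ ≤ ∑' J : Q, MeasureTheory.volume (J : Set ℝ) := MeasureTheory.measure_biUnion_le _ hQ _
      _ ≤ _ := ENNReal.tsum_mono_subtype (fun J : Set ℝ => MeasureTheory.volume J) hQT

end MaximalConnected

/-! ### Arcs and circles have parametrizations. -/

section Parametrizations

variable {X : Type*} [TopologicalSpace X] {C : Set X}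

theorem isParametrization_of_homeomorph (h : unitInterval ≃ₜ C) :
    IsParametrization C fun t => (h t : X) where
  continuous := continuous_subtype_val.comp h.continuous
  range_eq := by
    rw [← Function.comp_def, range_comp, h.surjective.range_eq, image_univ, Subtype.range_coe]
  injOn := (Subtype.coe_injective.comp h.injective).injOn

theorem injOn_circleExp {θ₀ θ₁ : ℝ} (hθ : θ₁ - θ₀ ≤ 2 * Real.pi) :
    InjOn Circle.exp (Ioo θ₀ θ₁) := by
  intro x hx y hy hxy
  obtain ⟨m, hm⟩ := Circle.exp_eq_exp.1 hxy
  have hpi := Real.pi_pos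
  have hm0 : m = 0 := by
    have h1 : (m : ℝ) < 1 := by
      by_contra! hc
      nlinarith [hx.1, hx.2, hy.1, hy.2]
    have h2 : (-1 : ℝ) < m := by
      by_contra! hc
      nlinarith [hx.1, hx.2, hy.1, hy.2]
    have h1' : m < 1 := by exact_mod_cast h1
    have h2' : -1 < m := by exact_mod_cast h2
    omega
  simpa [hm0] using hm

theorem isParametrization_of_circle (h : Circle ≃ₜ C) :
    IsParametrization C fun t : unitInterval => (h (Circle.exp (2 * Real.pi * t)) : X) where
  continuous := by fun_prop
  range_eq := by
    apply Subset.antisymm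
    · rintro _ ⟨t, rfl⟩
      exact Subtype.coe_prop _
    · intro z hz
      obtain ⟨w, hw⟩ := h.surjective ⟨z, hz⟩
      obtain ⟨θ, ⟨hθ0, hθ1⟩, hθ⟩ : ∃ θ ∈ Ico 0 (2 * Real.pi), Circle.exp θ = w := by
        refine ⟨toIcoMod Real.two_pi_pos 0 (Complex.arg w), ?_, ?_⟩
        · simpa using toIcoMod_mem_Ico Real.two_pi_pos 0 (Complex.arg w)
        · rw [← Circle.exp_arg w, Circle.exp_eq_exp]
          refine ⟨-toIcoDiv Real.two_pi_pos 0 (Complex.arg w), ?_⟩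
          rw [Circle.exp_arg, toIcoMod]
          push_cast
          simp only [zsmul_eq_mul]
          ring
      refine ⟨⟨θ / (2 * Real.pi), by positivity, ?_⟩, ?_⟩
      · exact (div_le_one Real.two_pi_pos).2 hθ1.le
      · have : 2 * Real.pi * (θ / (2 * Real.pi)) = θ := mul_div_cancel₀ _ Real.two_pi_pos.ne'
        simp only [this, hθ, hw]
  injOn := by
    intro s hs t ht hst
    have h1 := injOn_circleExp (θ₀ := 0) (θ₁ := 2 * Real.pi) (by simp) (x₁ := 2 * Real.pi * s)
      (x₂ := 2 * Real.pi * t) ?_ ?_ (h.injective (Subtype.coe_injective hst))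
    · exact Subtype.coe_injective (mul_left_cancel₀ Real.two_pi_pos.ne' h1)
    · have h0 : (0 : ℝ) < s := hs.1
      have h1 : (s : ℝ) < 1 := hs.2
      exact ⟨by positivity, by nlinarith [Real.two_pi_pos]⟩
    · have h0 : (0 : ℝ) < t := ht.1
      have h1 : (t : ℝ) < 1 := ht.2
      exact ⟨by positivity, by nlinarith [Real.two_pi_pos]⟩

end Parametrizations

/-! ### Evaluating the edge measure of arcs and circles. -/

namespace LengthGraph

variable {V : Type*} {G : SimpleGraph V} {ℓ : G.edgeSet → ℝ} (hℓ : ∀ e, 0 < ℓ e)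
  {C : Set (Space G ℓ)}

theorem eventually_edgeMap_mem_of_circle (h : Circle ≃ₜ C) (e : G.edgeSet) {a : ℝ}
    (ha : a ∈ Ioo 0 (ℓ e)) (haC : edgeMap hℓ e a ∈ C) : ∀ᶠ t in 𝓝 a, edgeMap hℓ e t ∈ C := by
  obtain ⟨w, hw⟩ := h.surjective ⟨_, haC⟩
  have hpi := Real.pi_pos
  -- Centring a window of length `2π` at the argument of `w` makes the point interior to an
  -- injective curve; a circle has no exceptional points.
  refine (eventually_edgeMap_mem_image hℓ e (g := fun θ => (h (Circle.exp θ) : Space G ℓ))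
    (p := Complex.arg w - Real.pi) (q := Complex.arg w + Real.pi) (c := Complex.arg w)
    (Continuous.continuousOn (by fun_prop)) ?_ ⟨by linarith, by linarith⟩ ha
    (by simp only [Circle.exp_arg, hw])).mono ?_
  · exact fun x hx y hy hxy => injOn_circleExp (by linarith) hx hy
      (h.injective (Subtype.coe_injective hxy))
  · rintro t ⟨x, -, hx⟩
    exact hx ▸ Subtype.coe_prop _

theorem eventually_edgeMap_mem_of_arc (h : unitInterval ≃ₜ C) (e : G.edgeSet) {a : ℝ}
    (ha : a ∈ Ioo 0 (ℓ e)) (haC : edgeMap hℓ e a ∈ C) (h0 : (h 0 : Space G ℓ) ≠ edgeMap hℓ e a)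
    (h1 : (h 1 : Space G ℓ) ≠ edgeMap hℓ e a) : ∀ᶠ t in 𝓝 a, edgeMap hℓ e t ∈ C := by
  obtain ⟨w, hw⟩ := h.surjective ⟨_, haC⟩
  have hw' : (h w : Space G ℓ) = edgeMap hℓ e a := congrArg Subtype.val hw
  have hw0 : 0 < w := unitInterval.pos_iff_ne_zero.2 fun hc => h0 (by rw [← hc, hw'])
  have hw1 : w < 1 := unitInterval.lt_one_iff_ne_one.2 fun hc => h1 (by rw [← hc, hw'])
  refine (eventually_edgeMap_mem_image hℓ e
    (g := fun x => (h (projIcc 0 1 zero_le_one x) : Space G ℓ)) (p := 0) (q := 1) (c := w)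
    (Continuous.continuousOn (by fun_prop)) ?_ ⟨hw0, hw1⟩ ha (by simp [hw'])).mono ?_
  · intro x hx y hy hxy
    have := h.injective (Subtype.coe_injective hxy)
    rw [projIcc_of_mem _ (Ioo_subset_Icc_self hx), projIcc_of_mem _ (Ioo_subset_Icc_self hy)] at this
    exact congrArg Subtype.val this
  · rintro t ⟨x, -, hx⟩
    exact hx ▸ Subtype.coe_prop _

theorem mem_edgesIn {X : Set (Space G ℓ)} {e : G.edgeSet} :
    e ∈ edgesIn ℓ X ↔ Icc 0 (ℓ e) ⊆ edgeMap hℓ e ⁻¹' X := by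
  constructor
  · intro h t ht
    rw [mem_preimage, edgeMap_of_mem hℓ e ht]
    exact h ⟨t, ht⟩
  · intro h t
    have := h t.2
    rwa [mem_preimage, edgeMap_of_mem hℓ e t.2] at this

/-- A closed set that is relatively open in the open edges it meets contains these edges. -/
theorem mem_edgesIn_of_eventually (hC : IsClosed C) {e : G.edgeSet}
    (hopen : ∀ a ∈ Ioo 0 (ℓ e), edgeMap hℓ e a ∈ C → ∀ᶠ t in 𝓝 a, edgeMap hℓ e t ∈ C)
    {a : ℝ} (ha : a ∈ Ioo 0 (ℓ e)) (haC : edgeMap hℓ e a ∈ C) : e ∈ edgesIn ℓ C := by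
  have hcl : IsClosed (edgeMap hℓ e ⁻¹' C) := hC.preimage (continuous_edgeMap hℓ e)
  have hint : ∀ b ∈ Ioo 0 (ℓ e), edgeMap hℓ e b ∈ C → b ∈ interior (edgeMap hℓ e ⁻¹' C) :=
    fun b hb hbC => mem_interior_iff_mem_nhds.2 (hopen b hb hbC)
  -- The interior of the preimage is also relatively closed in the open edge, since limits of it
  -- stay in the closed set `C`; connectedness gives the whole open edge.
  have hsub : Ioo 0 (ℓ e) ⊆ interior (edgeMap hℓ e ⁻¹' C) :=
    isPreconnected_Ioo.subset_of_closure_inter_subset isOpen_interior ⟨a, ha, hint a ha haC⟩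
      fun b hb => hint b hb.2 (hcl.closure_interior_subset hb.1)
  rw [mem_edgesIn hℓ, ← closure_Ioo (hℓ e).ne]
  exact hcl.closure_subset_iff.2 (hsub.trans interior_subset)

/-- An edge not contained in `C` meets it at most in its two ends and contributes measure `0`. -/
theorem traceLength_eq_tsum_edgesIn (hC : IsClosed C)
    (hopen : ∀ e, ∀ a ∈ Ioo 0 (ℓ e), edgeMap hℓ e a ∈ C → ∀ᶠ t in 𝓝 a, edgeMap hℓ e t ∈ C) :
    traceLength ℓ C = ∑' e : edgesIn ℓ C, ENNReal.ofReal (ℓ e) := by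
  rw [tsum_subtype (edgesIn ℓ C) fun e => ENNReal.ofReal (ℓ e)]
  refine tsum_congr fun e => ?_
  by_cases he : e ∈ edgesIn ℓ C
  · rw [indicator_of_mem he, edgeTrace_eq hℓ, inter_eq_left.2 ((mem_edgesIn hℓ).1 he),
      Real.volume_Icc, sub_zero]
  · rw [indicator_of_notMem he]
    refine MeasureTheory.measure_mono_null (t := {0, ℓ e}) (fun t ht => ?_)
      ((to_countable _).measure_zero _)
    obtain ⟨⟨h0, h1⟩, h⟩ := (mem_edgeTrace hℓ).1 ht
    by_contra hne
    simp only [mem_insert_iff, mem_singleton_iff, not_or] at hne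
    exact he (mem_edgesIn_of_eventually hℓ hC (hopen e)
      ⟨h0.lt_of_ne' hne.1, h1.lt_of_ne hne.2⟩ h)

theorem tsum_maxHalfEdgesIn_eq_traceLength
    (hnull : ∀ e, MeasureTheory.volume (edgeTrace ℓ C e \ interior (edgeTrace ℓ C e)) = 0) :
    ∑' p : maxHalfEdgesIn ℓ C, halfEdgeLength p.1 = traceLength ℓ C := by
  rw [tsum_subtype (maxHalfEdgesIn ℓ C) halfEdgeLength, ENNReal.tsum_prod']
  refine tsum_congr fun e => ?_
  rw [← tsum_volume_maximalConnected (hnull e), tsum_subtype (maximalConnected (edgeTrace ℓ C e))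
    fun J => MeasureTheory.volume J]
  rfl

/-- The trace can fail to be a neighbourhood only at the ends of the edge and where the edge hits an
endpoint of the arc: countably many parameters. -/
theorem volume_edgeTrace_diff_interior_of_arc (hℓ : ∀ e, 0 < ℓ e) (h : unitInterval ≃ₜ C)
    (e : G.edgeSet) :
    MeasureTheory.volume (edgeTrace ℓ C e \ interior (edgeTrace ℓ C e)) = 0 := by
  have hc : (edgeTrace ℓ {(h 0 : Space G ℓ), (h 1 : Space G ℓ)} e).Countable :=
    countable_edgeTrace hℓ (to_countable _) e
  refine MeasureTheory.measure_mono_null (fun t ht => ?_)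
    ((hc.union (to_countable {0, ℓ e})).measure_zero _)
  by_contra hne
  obtain ⟨htI, htC⟩ := (mem_edgeTrace hℓ).1 ht.1
  simp only [mem_union, mem_insert_iff, mem_singleton_iff, not_or, mem_edgeTrace hℓ, htI,
    true_and] at hne
  have htI' : t ∈ Ioo 0 (ℓ e) := ⟨htI.1.lt_of_ne' hne.2.1, htI.2.lt_of_ne hne.2.2⟩
  refine ht.2 (mem_interior_iff_mem_nhds.2 ?_)
  filter_upwards [eventually_edgeMap_mem_of_arc hℓ h e htI' htC (Ne.symm hne.1.1)
    (Ne.symm hne.1.2), Icc_mem_nhds htI'.1 htI'.2] with s hs hsI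
  exact (mem_edgeTrace hℓ).2 ⟨hsI, hs⟩

theorem hasLength_traceLength (hℓ : ∀ e, 0 < ℓ e) (hsum : Summable ℓ)
    (hC : ∃ γ : unitInterval → Space G ℓ, IsParametrization C γ) :
    HasLength C (traceLength ℓ C) :=
  ⟨hC, fun _ hγ => pathLength_eq_traceLength hℓ hsum hγ⟩

theorem isClosed_of_isParametrization {γ : unitInterval → Space G ℓ}
    (hγ : IsParametrization C γ) : IsClosed C :=
  hγ.range_eq ▸ (isCompact_range hγ.continuous).isClosed

end LengthGraph

theorem mainTheorem6 {V : Type*} (G : SimpleGraph V) (ℓ : G.edgeSet → ℝ) (hℓ : ∀ e, 0 < ℓ e)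
    (hsum : Summable ℓ) :
    (∀ C : Set (LengthGraph.Space G ℓ), IsCircle C →
      HasLength C (∑' e : LengthGraph.edgesIn ℓ C, ENNReal.ofReal (ℓ e))) ∧
    (∀ C : Set (LengthGraph.Space G ℓ), IsArc C →
      (∀ x, IsEndpoint C x → ¬ LengthGraph.IsInnerPoint ℓ x) →
      HasLength C (∑' e : LengthGraph.edgesIn ℓ C, ENNReal.ofReal (ℓ e))) ∧
    (∀ C : Set (LengthGraph.Space G ℓ), IsArc C →
      HasLength C (∑' p : LengthGraph.maxHalfEdgesIn ℓ C, LengthGraph.halfEdgeLength p.1)) := by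
  refine ⟨fun C ⟨h⟩ => ?_, fun C ⟨h⟩ hend => ?_, fun C ⟨h⟩ => ?_⟩
  · have hγ := isParametrization_of_circle h
    rw [← LengthGraph.traceLength_eq_tsum_edgesIn hℓ
      (LengthGraph.isClosed_of_isParametrization hγ)
      fun e a => LengthGraph.eventually_edgeMap_mem_of_circle hℓ h e]
    exact LengthGraph.hasLength_traceLength hℓ hsum ⟨_, hγ⟩
  · have hγ := isParametrization_of_homeomorph h
    rw [← LengthGraph.traceLength_eq_tsum_edgesIn hℓ
      (LengthGraph.isClosed_of_isParametrization hγ) fun e a ha haC =>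
        LengthGraph.eventually_edgeMap_mem_of_arc hℓ h e ha haC
          (fun h0 => hend _ ⟨h, Or.inl h0⟩ ((LengthGraph.isInnerPoint_iff hℓ).2 ⟨e, a, ha, rfl⟩))
          (fun h1 => hend _ ⟨h, Or.inr h1⟩ ((LengthGraph.isInnerPoint_iff hℓ).2 ⟨e, a, ha, rfl⟩))]
    exact LengthGraph.hasLength_traceLength hℓ hsum ⟨_, hγ⟩
  · rw [LengthGraph.tsum_maxHalfEdgesIn_eq_traceLength
      (LengthGraph.volume_edgeTrace_diff_interior_of_arc hℓ h)]
    exact LengthGraph.hasLength_traceLength hℓ hsum ⟨_, isParametrization_of_homeomorph h⟩
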